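/- **Theorem 2.** There are absolute constants $c_1,c_2,C>0$ such that the following holds. Let $K,m\ge 1$ and let $\mu$ be the law of a pair $(\mathcal X,y)$ with $\mathcal X\in\mathbb R^{n_1\times\cdots\times n_K}$, $y\in Y\subseteq\mathbb R$ almost surely, where the entries of $\mathcal X$ are independent standard Gaussians ($y$ may depend on $\mathcal X$ in any way). Let the loss $l:\mathbb R\times\mathbb R\to\mathbb R$ be measurable, and let $l(\cdot,y)$ be $\Lambda$-Lipschitz for every $y\in Y$. Let $R(\mathcal W)=\mathbb E_{(\mathcal X,y)\sim\mu}\,l(\langle\mathcal W,\mathcal X\rangle,y)$ be the expected risk, assumed to exist for every $\mathcal W$, and, for an i.i.d. sample $(\mathcal X_i,y_i)_{i=1}^m$ from $\mu$, let $\hat R(\mathcal W)=\frac1m\sum_{i=1}^m l(\langle\mathcal W,\mathcal X_i\rangle,y_i)$. Let $W_{(k)}$ be the mode-$k$ unfolding of $\mathcal W$, $\|\cdot\|_{\mathrm{tr}}$ the sum of the singular values of a matrix, and $$\|\mathcal W\|_{\mathrm{latent}}=\inf_{\mathcal W^{(1)}+\cdots+\mathcal W^{(K)}=\mathcal W}\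 \sum_{k=1}^K\|W^{(k)}_{(k)}\|_{\mathrm{tr}} .$$ Let $\mathcal W^0$ minimize $R$ subject to $\|\mathcal W\|_{\mathrm{latent}}\le B_0$, let $\|\mathcal W^0\|_{\mathrm F}\le B$, let $r_k$ be the rank of $W^0_{(k)}$, and suppose $B_0\le B\sqrt{\min_k r_k}$. Put $n_{\setminus k}=\prod_{j\ne k}n_j$ and let $0<\delta<1$. (i) If $l(z,y)\in[0,1]$ for all $z\in\mathbb R$, $y\in Y$, then with probability at least $1-\delta$ over the sample, every minimizer $\hat{\mathcal W}$ of $\hat R$ subject to $\|\mathcal W\|_{\mathrm{latent}}\le B_0$ satisfies $$R(\hat{\mathcal W})-R(\mathcal W^0)\le c_1\Lambda B\sqrt{\frac{\min_k r_k}{m}}\Bigl(\max_k\bigl(\sqrt{n_k}+\sqrt{n_{\setminus k}}\bigr)+C\sqrt{2\log K}\Bigr)+c_2\sqrt{\frac{\log(2/\delta)}{2m}} .$$ (ii) Without any boundedness of the loss, the same holds with $c_2$ replaced by $c_2\Lambda B_0$. -/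

import Mathlib

open MeasureTheory ProbabilityTheory
open scoped NNReal ENNReal

noncomputable section

/-- Real `K`-way tensors of size `n 0 × ⋯ × n (K - 1)`, as functions of a multi-index. -/
abbrev Tensor {K : ℕ} (n : Fin K → ℕ) : Type := ((j : Fin K) → Fin (n j)) → ℝ

namespace Tensor

variable {K : ℕ} {n : Fin K → ℕ}

/-- The inner product `⟨W, X⟩`, the sum of the entrywise products. -/
def dot (W X : Tensor n) : ℝ := ∑ i, W i * X i

/-- The Frobenius norm `√⟨W, W⟩`. -/
def frobeniusNorm (W : Tensor n) : ℝ := √(dot W W)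

/-- The mode-`k` unfolding: rows are indexed by the `k`-th index, and the columns (the mode-`k`
fibers) by all the other indices together. -/
def unfold (k : Fin K) (W : Tensor n) :
    Matrix (Fin (n k)) ((j : {j : Fin K // j ≠ k}) → Fin (n j)) ℝ :=
  Matrix.of fun a c => W ((Equiv.piSplitAt k (fun j => Fin (n j))).symm (a, c))

/-- The mode-`k` rank, the rank of the mode-`k` unfolding. -/
def modeRank (k : Fin K) (W : Tensor n) : ℕ := (unfold k W).rank

/-- The minimum `min_k r_k` of the multilinear rank (for `K ≥ 1`). -/
def minRank (W : Tensor n) : ℕ := ⨅ k : Fin K, modeRank k W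

end Tensor

/-- The trace norm of a real matrix: the sum of its non-zero singular values, with multiplicity. -/
def traceNorm {ι κ : Type} [Fintype ι] [Fintype κ] [DecidableEq κ] (A : Matrix ι κ ℝ) : ℝ :=
  (Matrix.toEuclideanLin A).singularValues.sum fun _ s => s

namespace Tensor

variable {K : ℕ} {n : Fin K → ℕ}

/-- The latent trace norm: the infimum over all decompositions `W = ∑ k, V k` of the sum over `k`
of the trace norms of the mode-`k` unfoldings of `V k`. -/
def latentNorm (W : Tensor n) : ℝ :=
  ⨅ V : {V : Fin K → Tensor n // ∑ k, V k = W}, ∑ k, traceNorm (unfold k (V.1 k))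

/-- The law of a tensor whose entries are independent standard Gaussians. -/
def stdGaussian (n : Fin K → ℕ) : Measure (Tensor n) :=
  Measure.pi fun _ => gaussianReal 0 1

/-- The expected risk of `W` for the loss `l` (prediction first, target second), the pair
`(X, y)` having law `μ`. -/
def risk (l : ℝ → ℝ → ℝ) (μ : Measure (Tensor n × ℝ)) (W : Tensor n) : ℝ :=
  ∫ p, l (dot W p.1) p.2 ∂μ

/-- The empirical risk of `W` on the training sample `S`. -/
def empRisk {m : ℕ} (l : ℝ → ℝ → ℝ) (S : Fin m → Tensor n × ℝ) (W : Tensor n) : ℝ :=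
  (1 / (m : ℝ)) * ∑ i, l (dot W (S i).1) (S i).2

/-- `W` minimizes the real function `R` among the tensors of latent trace norm at most `B₀`. -/
def IsLatentMinimizer (R : Tensor n → ℝ) (B₀ : ℝ) (W : Tensor n) : Prop :=
  latentNorm W ≤ B₀ ∧ ∀ V : Tensor n, latentNorm V ≤ B₀ → R W ≤ R V

/-- The dimension factor `max_k (√n_k + √n_{∖k})`, where `n_{∖k}` is the product of the other
dimensions (for `K ≥ 1`). -/
def dimFactor (n : Fin K → ℕ) : ℝ :=
  ⨆ k : Fin K, (√(n k : ℝ) + √(∏ j ∈ Finset.univ.erase k, (n j : ℝ)))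

/-- With probability at least `1 - δ` over an i.i.d. sample of size `m` from `μ`, each empirical
risk minimizer under the constraint `latentNorm ≤ B₀` has excess risk at most `b` over `W₀`. -/
def ExcessRiskLeWithProb (l : ℝ → ℝ → ℝ) (μ : Measure (Tensor n × ℝ)) (m : ℕ) (B₀ : ℝ)
    (W₀ : Tensor n) (b δ : ℝ) : Prop :=
  ∃ E : Set (Fin m → Tensor n × ℝ), MeasurableSet E ∧
    ENNReal.ofReal (1 - δ) ≤ Measure.pi (fun _ : Fin m => μ) E ∧
    ∀ S ∈ E, ∀ What : Tensor n, IsLatentMinimizer (empRisk l S) B₀ What →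
      risk l μ What - risk l μ W₀ ≤ b

end Tensor

end

/-!
The deviation of the empirical excess loss from its mean, uniformly over the ball of the latent
trace norm, is controlled through the exponential moments of its supremum, and all three classical
steps are carried out at the level of exponential moments.

*Symmetrization and contraction.* `lintegral_expSup_sub_le` treats one sample point. Convexity of
the exponential replaces the centred excess loss by a random sign times twice the excess loss, the
contraction principle `expSup_contraction` replaces the latter by the linear functional
`⟨W - W₀, X⟩` that dominates its increments, and the sign is absorbed by the symmetric Gaussian
`X`. The target `y` may depend on `X`, as the contraction is applied at each fixed sample point.
Tonelli's theorem allows the sample points to be exchanged one at a time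
(`lintegral_expSup_sum_le`).

*Gaussian tensors.* By trace duality (`abs_sum_mul_le_traceNorm_mul`) the functionals `⟨W, X⟩` on
the ball of radius `B₀` are at most `B₀` times the operator norms of the unfoldings of `X`. These
are bounded by the maximum of `⟨a, X⟩` over at most `K * 5 ^ max_k (n_k + n_{∖k})` tensors
`a` of norm at most `4` with an unfolding of rank one, coming from norming sets of the two factors
(`exists_norming_finset_latentNorm`). Bounding the exponential of the maximum by the sum gives a
sub-Gaussian bound with variance proxy `(16 Λ B₀)² / m` and entropy `log K + 2 * dimFactor n ^ 2`
(`lintegral_expSup_excessDeviation_le`).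

*Tails.* For arbitrary Lipschitz losses, the Chernoff bound (`measure_exists_mul_sqrt_lt_le`) gives
the estimate with `Λ * B₀` in the confidence term. For losses in `[0, 1]`, the exponential moments
are used for the mean of the supremum only, and McDiarmid's inequality
(`lintegral_exp_sub_integral_pi_le`) gives the fluctuations around it.

Suprema are taken over a dense sequence of the ball, which is enough for every empirical risk
minimizer because the deviation is continuous in the tensor
(`excessRiskLeWithProb_of_excessDeviation`).
-/

/-! ### Exponential suprema and the contraction principle -/

/-- The exponential of the supremum of a family of reals. It takes values in `ℝ≥0∞`, so that it
makes sense for unbounded families and can be integrated without integrability conditions. -/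
noncomputable def expSup {ι : Type*} (a : ι → ℝ) : ℝ≥0∞ :=
  ⨆ j, ENNReal.ofReal (Real.exp (a j))

lemma ofReal_exp_le_expSup {ι : Type*} (a : ι → ℝ) (j : ι) :
    ENNReal.ofReal (Real.exp (a j)) ≤ expSup a :=
  le_iSup (fun j => ENNReal.ofReal (Real.exp (a j))) j

lemma measurable_expSup {ι α : Type*} [Countable ι] [MeasurableSpace α] {a : α → ι → ℝ}
    (ha : ∀ j, Measurable fun x => a x j) : Measurable fun x => expSup (a x) :=
  Measurable.iSup fun j => ((ha j).exp).ennreal_ofReal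

lemma ofReal_exp_iSup_le_expSup {ι : Type*} [Nonempty ι] {a : ι → ℝ}
    (ha : BddAbove (Set.range a)) :
    ENNReal.ofReal (Real.exp (⨆ j, a j)) ≤ expSup a := by
  have hc : Continuous fun x : ℝ => ENNReal.ofReal (Real.exp x) :=
    ENNReal.continuous_ofReal.comp Real.continuous_exp
  have hmono : Monotone fun x : ℝ => ENNReal.ofReal (Real.exp x) := fun x y hxy =>
    ENNReal.ofReal_le_ofReal (Real.exp_le_exp.2 hxy)
  exact (hmono.map_ciSup_of_continuousAt hc.continuousAt ha).le

lemma expSup_le_sum_of_forall_exists {ι α : Type*} (A : Finset α) (x : ι → ℝ) (y : α → ℝ)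
    (h : ∃ a ∈ A, ∀ j, x j ≤ y a) :
    expSup x ≤ ∑ a ∈ A, ENNReal.ofReal (Real.exp (y a)) := by
  obtain ⟨a, ha, hxy⟩ := h
  refine (iSup_le fun j => ENNReal.ofReal_le_ofReal (Real.exp_le_exp.2 (hxy j))).trans ?_
  exact Finset.single_le_sum (f := fun a => ENNReal.ofReal (Real.exp (y a)))
    (fun _ _ => zero_le) ha

lemma exp_sub_exp_le {a b a' b' : ℝ} (hab : a ≤ b) (haa : a ≤ a') (h : b - a ≤ b' - a') :
    Real.exp b - Real.exp a ≤ Real.exp b' - Real.exp a' := by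
  have e : ∀ x y : ℝ, Real.exp y - Real.exp x = Real.exp x * (Real.exp (y - x) - 1) := by
    intro x y
    rw [mul_sub, ← Real.exp_add]; simp
  rw [e, e]
  have h1 : 0 ≤ Real.exp (b - a) - 1 := by
    linarith [Real.one_le_exp (sub_nonneg.2 hab)]
  have h2 : Real.exp (b - a) ≤ Real.exp (b' - a') := Real.exp_le_exp.2 h
  exact mul_le_mul (Real.exp_le_exp.2 haa) (by linarith) h1 (Real.exp_pos _).le

/-- The two-point contraction inequality for increments of the same sign. -/
lemma exp_add_exp_le_of_nonneg {a b p q u v : ℝ} (hu : |p| ≤ u) (hv : |q| ≤ v)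
    (hpq : |p - q| ≤ |u - v|) (h₁ : b + q ≤ a + p) (h₂ : a - p ≤ b - q) :
    Real.exp (a + p) + Real.exp (b - q) ≤
      max (Real.exp (a + u) + Real.exp (b - v)) (Real.exp (b + v) + Real.exp (a - u)) := by
  obtain ⟨hu1, hu2⟩ := abs_le.1 hu
  obtain ⟨hv1, hv2⟩ := abs_le.1 hv
  obtain ⟨h3, h4⟩ := abs_le.1 hpq
  rcases le_total v u with h | h
  · rw [abs_of_nonneg (sub_nonneg.2 h)] at h3 h4
    refine le_max_of_le_left ?_
    have := exp_sub_exp_le (a := b - v) (b := b - q) (a' := a + p) (b' := a + u)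
      (by linarith) (by linarith) (by linarith)
    linarith
  · rw [abs_of_nonpos (sub_nonpos.2 h)] at h3 h4
    refine le_max_of_le_right ?_
    have := exp_sub_exp_le (a := a - u) (b := a + p) (a' := b - q) (b' := b + v)
      (by linarith) (by linarith) (by linarith)
    linarith

lemma exp_add_exp_neg_le {p u : ℝ} (a : ℝ) (h : |p| ≤ |u|) :
    Real.exp (a + p) + Real.exp (a - p) ≤ Real.exp (a + u) + Real.exp (a - u) := by
  have e : ∀ x : ℝ, Real.exp (a + x) + Real.exp (a - x) = 2 * (Real.exp a * Real.cosh x) := by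
    intro x
    rw [Real.cosh_eq, sub_eq_add_neg, Real.exp_add, Real.exp_add]; ring
  rw [e, e]
  have := Real.cosh_le_cosh.2 h
  have := Real.exp_pos a
  gcongr

/-- **Contraction principle** for a single Rademacher sign: replacing the increments `x j` by
their images `p j` under a contraction fixing `0` does not increase the mean of the exponential
supremum. -/
lemma expSup_contraction {ι : Type*} [Nonempty ι] (a p x : ι → ℝ) (h0 : ∀ j, |p j| ≤ |x j|)
    (h : ∀ j k, |p j - p k| ≤ |x j - x k|) :
    expSup (fun j => a j + p j) + expSup (fun j => a j - p j) ≤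
      expSup (fun j => a j + x j) + expSup (fun j => a j - x j) := by
  have key : ∀ (j k : ι) (r : ℝ), r ≤ Real.exp (a j + x j) + Real.exp (a k - x k) →
      ENNReal.ofReal r ≤ expSup (fun j => a j + x j) + expSup (fun j => a j - x j) := by
    intro j k r hr
    refine (ENNReal.ofReal_le_ofReal hr).trans ?_
    rw [ENNReal.ofReal_add (Real.exp_pos _).le (Real.exp_pos _).le]
    exact add_le_add (ofReal_exp_le_expSup (fun j => a j + x j) j)
      (ofReal_exp_le_expSup (fun j => a j - x j) k)
  refine ENNReal.iSup_add_iSup_le fun j k => ?_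
  rw [← ENNReal.ofReal_add (Real.exp_pos _).le (Real.exp_pos _).le]
  -- Unless `j` and `k` are extremal for the two signs, a diagonal pair does better.
  rcases lt_or_ge (a j + p j) (a k + p k) with h₁ | h₁
  · refine key k k _ (le_trans ?_ (exp_add_exp_neg_le (a k) (h0 k)))
    gcongr
  rcases lt_or_ge (a k - p k) (a j - p j) with h₂ | h₂
  · refine key j j _ (le_trans ?_ (exp_add_exp_neg_le (a j) (h0 j)))
    gcongr
  have hj := h0 j
  have hk := h0 k
  have hjk := h j k
  obtain ⟨j1, j2⟩ := abs_le.1 hj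
  obtain ⟨k1, k2⟩ := abs_le.1 hk
  rcases le_total 0 (x j) with xj | xj <;> rcases le_total 0 (x k) with xk | xk
  · rw [abs_of_nonneg xj] at hj
    rw [abs_of_nonneg xk] at hk
    rcases le_max_iff.1 (exp_add_exp_le_of_nonneg hj hk hjk h₁ h₂) with h3 | h3
    · exact key j k _ h3
    · exact key k j _ h3
  · rw [abs_of_nonneg xj] at j2
    rw [abs_of_nonpos xk] at k1
    exact key j k _ (add_le_add (Real.exp_le_exp.2 (by linarith))
      (Real.exp_le_exp.2 (by linarith)))
  · rw [abs_of_nonpos xj] at j2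
    rw [abs_of_nonneg xk] at k1
    refine key k j _ ?_
    rw [add_comm (Real.exp (a k + x k))]
    exact add_le_add (Real.exp_le_exp.2 (by linarith)) (Real.exp_le_exp.2 (by linarith))
  · rw [abs_of_nonpos xj] at hj
    rw [abs_of_nonpos xk] at hk
    have hjk' : |p j - p k| ≤ |-x j - -x k| := by
      rwa [← abs_neg (-x j - -x k), show -(-x j - -x k) = x j - x k by ring]
    rcases le_max_iff.1 (exp_add_exp_le_of_nonneg hj hk hjk' h₁ h₂) with h3 | h3
    · refine key k j _ (h3.trans_eq ?_)
      rw [add_comm, sub_neg_eq_add, ← sub_eq_add_neg]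
    · refine key j k _ (h3.trans_eq ?_)
      rw [add_comm, sub_neg_eq_add, ← sub_eq_add_neg]

/-! ### Symmetrization -/

/-- Jensen's inequality for the exponential, with a possibly infinite right-hand side. -/
lemma ofReal_exp_integral_le {Ω : Type*} [MeasurableSpace Ω] {μ : Measure Ω}
    [IsProbabilityMeasure μ] {f : Ω → ℝ} (hf : Integrable f μ) :
    ENNReal.ofReal (Real.exp (∫ x, f x ∂μ)) ≤ ∫⁻ x, ENNReal.ofReal (Real.exp (f x)) ∂μ := by
  by_cases hi : ∫⁻ x, ENNReal.ofReal (Real.exp (f x)) ∂μ = ∞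
  · simp [hi]
  have hexp : Integrable (fun x => Real.exp (f x)) μ := by
    refine ⟨hf.aestronglyMeasurable.aemeasurable.exp.aestronglyMeasurable, ?_⟩
    rw [hasFiniteIntegral_iff_ofReal (Filter.Eventually.of_forall fun x => (Real.exp_pos _).le)]
    exact lt_top_iff_ne_top.2 hi
  rw [← ofReal_integral_eq_lintegral_ofReal hexp
    (Filter.Eventually.of_forall fun x => (Real.exp_pos _).le)]
  refine ENNReal.ofReal_le_ofReal ?_
  exact convexOn_exp.map_integral_le Real.continuous_exp.continuousOn isClosed_univ
    (Filter.Eventually.of_forall fun _ => Set.mem_univ _) hf hexp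

/-- One step of symmetrization, contraction and comparison: the centred increments `h j` can be
replaced by the functions `s j` that dominate them, provided that `s` has a symmetric
distribution. -/
lemma lintegral_expSup_sub_le {Ω ι : Type*} [MeasurableSpace Ω] [Countable ι] [Nonempty ι]
    {μ : Measure Ω} [IsProbabilityMeasure μ] {h s : ι → Ω → ℝ}
    (hm : ∀ j, Measurable (h j)) (hi : ∀ j, Integrable (h j) μ) (sm : ∀ j, Measurable (s j))
    (h0 : ∀ j z, |2 * h j z| ≤ |s j z|) (hL : ∀ j k z, |2 * h j z - 2 * h k z| ≤ |s j z - s k z|)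
    (hs : ∀ a : ι → ℝ, ∫⁻ z, expSup (fun j => a j - s j z) ∂μ =
      ∫⁻ z, expSup (fun j => a j + s j z) ∂μ) (a : ι → ℝ) :
    ∫⁻ z, expSup (fun j => a j + (∫ w, h j w ∂μ - h j z)) ∂μ ≤
      ∫⁻ z, expSup (fun j => a j + s j z) ∂μ := by
  have mp : ∀ f : ι → Ω → ℝ, (∀ j, Measurable (f j)) →
      Measurable fun z => expSup (fun j => a j + f j z) := fun f hf =>
    measurable_expSup fun j => measurable_const.add (hf j)
  have mn : ∀ f : ι → Ω → ℝ, (∀ j, Measurable (f j)) →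
      Measurable fun z => expSup (fun j => a j - f j z) := fun f hf =>
    measurable_expSup fun j => measurable_const.sub (hf j)
  have half : ∀ t : ℝ≥0∞, 2⁻¹ * (t + t) = t := by
    intro t
    rw [← two_mul, ← mul_assoc, ENNReal.inv_mul_cancel (by simp) (by simp), one_mul]
  have h2m : ∀ j, Measurable fun z => 2 * h j z := fun j => (hm j).const_mul 2
  -- Convexity splits the difference of two independent copies into its two halves.
  have split : ∀ j w z, ENNReal.ofReal (Real.exp (a j + (h j w - h j z))) ≤
      2⁻¹ * (expSup (fun j => a j + 2 * h j w) + expSup (fun j => a j - 2 * h j z)) := by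
    intro j w z
    have hc : Real.exp (a j + (h j w - h j z)) ≤
        2⁻¹ * (Real.exp (a j + 2 * h j w) + Real.exp (a j - 2 * h j z)) := by
      have := convexOn_exp.2 (Set.mem_univ (a j + 2 * h j w)) (Set.mem_univ (a j - 2 * h j z))
        (by norm_num : (0 : ℝ) ≤ 2⁻¹) (by norm_num : (0 : ℝ) ≤ 2⁻¹) (by norm_num)
      simp only [smul_eq_mul] at this
      rwa [← mul_add, ← mul_add, show 2⁻¹ * (a j + 2 * h j w + (a j - 2 * h j z)) =
        a j + (h j w - h j z) by ring] at this
    refine (ENNReal.ofReal_le_ofReal hc).trans ?_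
    rw [ENNReal.ofReal_mul (by norm_num), ENNReal.ofReal_add (Real.exp_pos _).le
      (Real.exp_pos _).le, ENNReal.ofReal_inv_of_pos (by norm_num)]
    simp only [ENNReal.ofReal_ofNat]
    gcongr
    · exact ofReal_exp_le_expSup (fun j => a j + 2 * h j w) j
    · exact ofReal_exp_le_expSup (fun j => a j - 2 * h j z) j
  calc ∫⁻ z, expSup (fun j => a j + (∫ w, h j w ∂μ - h j z)) ∂μ
      ≤ ∫⁻ z, 2⁻¹ * ((∫⁻ w, expSup (fun j => a j + 2 * h j w) ∂μ) +
          expSup (fun j => a j - 2 * h j z)) ∂μ := by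
        refine lintegral_mono fun z => iSup_le fun j => ?_
        have e : a j + (∫ w, h j w ∂μ - h j z) = ∫ w, (a j + (h j w - h j z)) ∂μ := by
          have hd : Integrable (fun w => h j w - h j z) μ := (hi j).sub (integrable_const _)
          rw [integral_add (integrable_const _) hd, integral_sub (hi j) (integrable_const _)]
          simp
        beta_reduce
        rw [e]
        refine (ofReal_exp_integral_le
          ((integrable_const _).add ((hi j).sub (integrable_const _)))).trans ?_
        refine (lintegral_mono fun w => split j w z).trans_eq ?_
        rw [lintegral_const_mul _ ((mp _ h2m).add_const _),
          lintegral_add_left (mp _ h2m)]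
        simp
    _ = 2⁻¹ * ∫⁻ z, (expSup (fun j => a j + 2 * h j z) +
          expSup (fun j => a j - 2 * h j z)) ∂μ := by
        rw [lintegral_const_mul _ ((mn _ h2m).const_add _),
          lintegral_add_left measurable_const, lintegral_add_left (mp _ h2m)]
        simp
    _ ≤ 2⁻¹ * ∫⁻ z, (expSup (fun j => a j + s j z) + expSup (fun j => a j - s j z)) ∂μ := by
        refine mul_le_mul_right (lintegral_mono fun z => ?_) _
        exact expSup_contraction a _ _ (fun j => h0 j z) (fun j k => hL j k z)
    _ = ∫⁻ z, expSup (fun j => a j + s j z) ∂μ := by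
        rw [lintegral_add_left (mp _ sm), hs, half]

/-- Tonelli's theorem for the first coordinate of a power of a measure. -/
lemma lintegral_pi_fin_succ {Ω : Type*} [MeasurableSpace Ω] (μ : Measure Ω)
    [IsProbabilityMeasure μ] (m : ℕ) {f : (Fin (m + 1) → Ω) → ℝ≥0∞} (hf : Measurable f) :
    ∫⁻ S, f S ∂(Measure.pi fun _ => μ) =
      ∫⁻ S, ∫⁻ z, f (Fin.cons z S) ∂μ ∂(Measure.pi fun _ : Fin m => μ) := by
  have e := (measurePreserving_piFinSuccAbove (fun _ : Fin (m + 1) => μ) 0).symm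
  rw [← e.lintegral_comp hf,
    lintegral_prod_symm' (fun z => f _) (hf.comp e.measurable)]
  simp [MeasurableEquiv.piFinSuccAbove_symm_apply, Fin.insertNthEquiv]

/-- Comparison of the empirical process of `h` with the sums of the dominating functions `s`,
by applying `lintegral_expSup_sub_le` to one sample point at a time. -/
lemma lintegral_expSup_sum_le {Ω ι : Type*} [MeasurableSpace Ω] [Countable ι] [Nonempty ι]
    {μ : Measure Ω} [IsProbabilityMeasure μ] {h s : ι → Ω → ℝ}
    (hm : ∀ j, Measurable (h j)) (hi : ∀ j, Integrable (h j) μ) (sm : ∀ j, Measurable (s j))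
    (h0 : ∀ j z, |2 * h j z| ≤ |s j z|) (hL : ∀ j k z, |2 * h j z - 2 * h k z| ≤ |s j z - s k z|)
    (hs : ∀ a : ι → ℝ, ∫⁻ z, expSup (fun j => a j - s j z) ∂μ =
      ∫⁻ z, expSup (fun j => a j + s j z) ∂μ) (m : ℕ) (a : ι → ℝ) :
    ∫⁻ S, expSup (fun j => a j + ∑ i, (∫ w, h j w ∂μ - h j (S i)))
        ∂(Measure.pi fun _ : Fin m => μ) ≤
      ∫⁻ S, expSup (fun j => a j + ∑ i, s j (S i)) ∂(Measure.pi fun _ : Fin m => μ) := by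
  induction m generalizing a with
  | zero => simp
  | succ m ih =>
    have hm' : ∀ j (i : ℕ) (k : Fin i), Measurable fun S : Fin i → Ω => h j (S k) :=
      fun j i k => (hm j).comp (measurable_pi_apply k)
    have sm' : ∀ j (i : ℕ) (k : Fin i), Measurable fun S : Fin i → Ω => s j (S k) :=
      fun j i k => (sm j).comp (measurable_pi_apply k)
    rw [lintegral_pi_fin_succ, lintegral_pi_fin_succ]
    rotate_left
    · exact measurable_expSup fun j => measurable_const.add
        (Finset.measurable_sum _ fun i _ => sm' j _ i)
    · exact measurable_expSup fun j => measurable_const.add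
        (Finset.measurable_sum _ fun i _ => measurable_const.sub (hm' j _ i))
    simp only [Fin.sum_univ_succ, Fin.cons_zero, Fin.cons_succ]
    calc ∫⁻ S, ∫⁻ z, expSup (fun j => a j + ((∫ w, h j w ∂μ - h j z) +
            ∑ i, (∫ w, h j w ∂μ - h j (S i)))) ∂μ ∂(Measure.pi fun _ : Fin m => μ)
        ≤ ∫⁻ S, ∫⁻ z, expSup (fun j => (a j + ∑ i, (∫ w, h j w ∂μ - h j (S i))) + s j z) ∂μ
            ∂(Measure.pi fun _ : Fin m => μ) := by
          refine lintegral_mono fun S => ?_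
          refine le_of_eq_of_le ?_ (lintegral_expSup_sub_le hm hi sm h0 hL hs
            (fun j => a j + ∑ i, (∫ w, h j w ∂μ - h j (S i))))
          congr! 4
          ring
      _ = ∫⁻ z, ∫⁻ S, expSup (fun j => (a j + s j z) + ∑ i, (∫ w, h j w ∂μ - h j (S i)))
            ∂(Measure.pi fun _ : Fin m => μ) ∂μ := by
          rw [lintegral_lintegral_swap]
          · congr! 6
            ring
          · refine Measurable.aemeasurable (measurable_expSup fun j => ?_)
            exact (measurable_const.add (Finset.measurable_sum _ fun i _ =>
              measurable_const.sub ((hm' j _ i).comp measurable_fst))).add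
              ((sm j).comp measurable_snd)
      _ ≤ ∫⁻ z, ∫⁻ S, expSup (fun j => (a j + s j z) + ∑ i, s j (S i))
            ∂(Measure.pi fun _ : Fin m => μ) ∂μ := by
          exact lintegral_mono fun z => ih _
      _ = _ := by
          rw [lintegral_lintegral_swap]
          · congr! 6
            ring
          · refine Measurable.aemeasurable (measurable_expSup fun j => ?_)
            exact (measurable_const.add ((sm j).comp measurable_fst)).add
              (Finset.measurable_sum _ fun i _ => (sm' j _ i).comp measurable_snd)

/-! ### Tail bounds from exponential moments -/

/-- Optimization of the parameter `t` in a sub-Gaussian Chernoff bound. -/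
lemma le_mul_sqrt_of_forall_mul_le {x L σ : ℝ} (hL : 0 ≤ L) (hσ : 0 ≤ σ)
    (h : ∀ t : ℝ, 0 < t → t * x ≤ L + t ^ 2 * σ ^ 2 / 2) : x ≤ σ * √(2 * L) := by
  by_contra! hx
  have hx0 : 0 < x := lt_of_le_of_lt (by positivity) hx
  rcases hσ.eq_or_lt with rfl | hσ
  · have := h ((L + 1) / x) (by positivity)
    rw [div_mul_cancel₀ _ hx0.ne'] at this
    norm_num at this
  · have := h (x / σ ^ 2) (by positivity)
    have h1 : x ^ 2 / σ ^ 2 ≤ 2 * L := by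
      have e1 : x / σ ^ 2 * x = x ^ 2 / σ ^ 2 := by ring
      have e2 : (x / σ ^ 2) ^ 2 * σ ^ 2 / 2 = x ^ 2 / σ ^ 2 / 2 := by
        field_simp
      rw [e1, e2] at this
      linarith
    have h2 : x / σ ≤ √(2 * L) := Real.le_sqrt_of_sq_le (by rwa [div_pow])
    rw [div_le_iff₀ hσ] at h2
    linarith

/-- Chernoff bound, uniform over a countable family of random variables. The inequality in the
event is strict, so the degenerate case `σ = 0` is covered too. -/
lemma measure_exists_mul_sqrt_lt_le {Ω ι : Type*} [MeasurableSpace Ω] [Countable ι]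
    {P : Measure Ω} [IsProbabilityMeasure P] {G : ι → Ω → ℝ} (hG : ∀ j, Measurable (G j))
    {L σ : ℝ} (hL : 0 ≤ L) (hσ : 0 ≤ σ)
    (h : ∀ t : ℝ, 0 < t →
      ∫⁻ ω, expSup (fun j => t * G j ω) ∂P ≤ ENNReal.ofReal (Real.exp (L + t ^ 2 * σ ^ 2 / 2)))
    {δ : ℝ} (hδ : 0 < δ) (hδ1 : δ < 1) :
    P {ω | ∃ j, σ * √(2 * (L + Real.log (1 / δ))) < G j ω} ≤ ENNReal.ofReal δ := by
  set b := σ * √(2 * (L + Real.log (1 / δ))) with hb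
  have hlog : 0 ≤ Real.log (1 / δ) := Real.log_nonneg (by rw [le_div_iff₀ hδ]; linarith)
  have key : ∀ b', b < b' → P {ω | ∃ j, b' < G j ω} ≤ ENNReal.ofReal δ := by
    intro b' hb'
    by_contra! hlt
    refine hb'.not_ge (le_mul_sqrt_of_forall_mul_le (by positivity) hσ fun t ht => ?_)
    have h1 : ENNReal.ofReal (Real.exp (t * b')) * ENNReal.ofReal δ ≤
        ENNReal.ofReal (Real.exp (L + t ^ 2 * σ ^ 2 / 2)) := by
      refine le_trans ?_ (h t ht)
      refine le_trans ?_ (mul_meas_ge_le_lintegral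
        (measurable_expSup fun j => (hG j).const_mul t) (ENNReal.ofReal (Real.exp (t * b'))))
      gcongr
      refine hlt.le.trans (measure_mono ?_)
      rintro ω ⟨j, hj⟩
      refine le_trans (ENNReal.ofReal_le_ofReal (Real.exp_le_exp.2 ?_))
        (ofReal_exp_le_expSup (fun j => t * G j ω) j)
      gcongr
    rw [← ENNReal.ofReal_mul (Real.exp_pos _).le,
      ENNReal.ofReal_le_ofReal_iff (Real.exp_pos _).le] at h1
    have h2 := Real.log_le_log (by positivity) h1
    rw [Real.log_mul (Real.exp_pos _).ne' hδ.ne', Real.log_exp, Real.log_exp] at h2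
    rw [one_div, Real.log_inv]
    linarith
  have hU : {ω | ∃ j, b < G j ω} = ⋃ k : ℕ, {ω | ∃ j, b + 1 / ((k : ℝ) + 1) < G j ω} := by
    ext ω
    simp only [Set.mem_ofPred_eq, Set.mem_iUnion]
    constructor
    · rintro ⟨j, hj⟩
      obtain ⟨k, hk⟩ := exists_nat_one_div_lt (sub_pos.2 hj)
      exact ⟨k, j, by linarith⟩
    · rintro ⟨k, j, hj⟩
      exact ⟨j, lt_trans (by linarith [Nat.one_div_pos_of_nat (α := ℝ) (n := k)]) hj⟩
  have hmono : Monotone fun k : ℕ => {ω | ∃ j, b + 1 / ((k : ℝ) + 1) < G j ω} := by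
    rintro k k' hk ω ⟨j, hj⟩
    refine ⟨j, lt_of_le_of_lt ?_ hj⟩
    have := Nat.one_div_le_one_div (α := ℝ) hk
    linarith
  rw [hU, hmono.measure_iUnion]
  exact iSup_le fun k => key _ (by linarith [Nat.one_div_pos_of_nat (α := ℝ) (n := k)])

/-! ### The bounded differences inequality -/

/-- Hoeffding's lemma for a function of oscillation at most `c`. -/
lemma lintegral_exp_sub_integral_le {Ω : Type*} [MeasurableSpace Ω] {μ : Measure Ω}
    [IsProbabilityMeasure μ] {f : Ω → ℝ} (hf : Measurable f) {c : ℝ}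
    (hc : ∀ z w, f z - f w ≤ c) (t : ℝ) :
    ∫⁻ z, ENNReal.ofReal (Real.exp (t * (f z - ∫ w, f w ∂μ))) ∂μ ≤
      ENNReal.ofReal (Real.exp (t ^ 2 * c ^ 2 / 8)) := by
  have hne : Nonempty Ω := nonempty_of_isProbabilityMeasure μ
  have hb : BddBelow (Set.range f) := by
    obtain ⟨z⟩ := hne
    exact ⟨f z - c, by rintro _ ⟨w, rfl⟩; linarith [hc z w]⟩
  have hsub := hasSubgaussianMGF_of_mem_Icc (μ := μ) (a := ⨅ w, f w) (b := (⨅ w, f w) + c)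
    hf.aemeasurable (Filter.Eventually.of_forall fun z => ⟨ciInf_le hb z, by
      have : f z - c ≤ ⨅ w, f w := le_ciInf fun w => by linarith [hc z w]
      linarith⟩)
  rw [← ofReal_integral_eq_lintegral_ofReal (hsub.integrable_exp_mul t)
    (Filter.Eventually.of_forall fun _ => (Real.exp_pos _).le)]
  refine ENNReal.ofReal_le_ofReal ((hsub.mgf_le t).trans_eq ?_)
  congr 1
  rw [add_sub_cancel_left]
  push_cast
  rw [Real.norm_eq_abs, div_pow, sq_abs]
  ring

lemma measurable_fin_cons {Ω : Type*} [MeasurableSpace Ω] (m : ℕ) :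
    Measurable fun p : Ω × (Fin m → Ω) => (Fin.cons p.1 p.2 : Fin (m + 1) → Ω) := by
  refine measurable_pi_iff.2 fun i => ?_
  refine Fin.cases ?_ (fun i => ?_) i
  · simpa using measurable_fst
  · exact (measurable_pi_apply i).comp measurable_snd

/-- **McDiarmid's inequality**, in the form of a bound on the exponential moments. -/
lemma lintegral_exp_sub_integral_pi_le {Ω : Type*} [MeasurableSpace Ω] {μ : Measure Ω}
    [IsProbabilityMeasure μ] (m : ℕ) {F : (Fin m → Ω) → ℝ} (hF : Measurable F) {M : ℝ}
    (hM : ∀ S, |F S| ≤ M) {c : ℝ} (hc : ∀ S i z w,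
      F (Function.update S i z) - F (Function.update S i w) ≤ c) (t : ℝ) :
    ∫⁻ S, ENNReal.ofReal (Real.exp (t * (F S - ∫ S, F S ∂(Measure.pi fun _ => μ))))
        ∂(Measure.pi fun _ => μ) ≤
      ENNReal.ofReal (Real.exp (m * (t ^ 2 * c ^ 2 / 8))) := by
  induction m with
  | zero =>
    rw [Measure.pi_of_empty _ isEmptyElim]
    simp
  | succ m ih =>
    have hcons : ∀ S : Fin m → Ω, Measurable fun z => F (Fin.cons z S) := fun S =>
      hF.comp ((measurable_fin_cons m).comp (measurable_id.prodMk measurable_const))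
    have hbd : ∀ S : Fin m → Ω, Integrable (fun z => F (Fin.cons z S)) μ := fun S =>
      Integrable.of_bound (hcons S).aestronglyMeasurable M
        (Filter.Eventually.of_forall fun z => hM _)
    set Fb : (Fin m → Ω) → ℝ := fun S => ∫ z, F (Fin.cons z S) ∂μ with hFb
    have hmeas : Measurable fun p : Ω × (Fin m → Ω) => F (Fin.cons p.1 p.2) :=
      hF.comp (measurable_fin_cons m)
    have hFbm : Measurable Fb := (hmeas.stronglyMeasurable.integral_prod_left').measurable
    have hint : ∫ S, F S ∂(Measure.pi fun _ => μ) = ∫ S, Fb S ∂(Measure.pi fun _ => μ) := by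
      have e := (measurePreserving_piFinSuccAbove (fun _ : Fin (m + 1) => μ) 0).symm
      rw [← e.integral_comp', integral_prod_symm]
      · simp [hFb, MeasurableEquiv.piFinSuccAbove_symm_apply, Fin.insertNthEquiv]
      · exact Integrable.of_bound (hF.comp e.measurable).aestronglyMeasurable M
          (Filter.Eventually.of_forall fun z => hM _)
    have hFbM : ∀ S, |Fb S| ≤ M := fun S => by
      have := norm_integral_le_of_norm_le_const (μ := μ) (f := fun z => F (Fin.cons z S))
        (Filter.Eventually.of_forall fun z => hM (Fin.cons z S))
      simpa using this
    have hFbc : ∀ S i z w, Fb (Function.update S i z) - Fb (Function.update S i w) ≤ c := by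
      intro S i z w
      rw [hFb, ← integral_sub (hbd _) (hbd _)]
      refine (integral_mono ((hbd _).sub (hbd _)) (integrable_const c) fun x => ?_).trans_eq
        (by simp)
      simp only [Fin.cons_update]
      exact hc _ _ _ _
    have hosc : ∀ S z w, F (Fin.cons z S) - F (Fin.cons w S) ≤ c := by
      intro S z w
      have := hc (Fin.cons z S) 0 z w
      simpa using this
    rw [lintegral_pi_fin_succ _ _ (((hF.sub_const _).const_mul t).exp.ennreal_ofReal), hint]
    have hsplit : ∀ S, ∫⁻ z, ENNReal.ofReal (Real.exp (t * (F (Fin.cons z S) -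
        ∫ S, Fb S ∂(Measure.pi fun _ => μ)))) ∂μ ≤
        ENNReal.ofReal (Real.exp (t * (Fb S - ∫ S, Fb S ∂(Measure.pi fun _ => μ)))) *
          ENNReal.ofReal (Real.exp (t ^ 2 * c ^ 2 / 8)) := by
      intro S
      refine le_trans ?_ (mul_le_mul_right
        (lintegral_exp_sub_integral_le (μ := μ) (hcons S) (hosc S) t) _)
      rw [← lintegral_const_mul _ (((hcons S).sub_const _).const_mul t).exp.ennreal_ofReal]
      refine lintegral_mono fun z => le_of_eq ?_
      rw [← ENNReal.ofReal_mul (Real.exp_pos _).le, ← Real.exp_add]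
      congr 2
      ring
    refine (lintegral_mono hsplit).trans ?_
    rw [lintegral_mul_const _ ((hFbm.sub_const _).const_mul t).exp.ennreal_ofReal]
    refine (mul_le_mul_left (ih hFbm hFbM hFbc) _).trans_eq ?_
    rw [← ENNReal.ofReal_mul (Real.exp_pos _).le, ← Real.exp_add]
    congr 2
    push_cast
    ring

/-! ### Norming nets and trace duality -/

/-- A maximal `1`-separated subset of the ball of radius `2` is norming: it has at most `5 ^ dim`
elements, and the norm is at most the supremum of the inner products with them. -/
lemma exists_norming_finset (E : Type*) [NormedAddCommGroup E] [InnerProductSpace ℝ E]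
    [FiniteDimensional ℝ E] : ∃ s : Finset E, s.card ≤ 5 ^ Module.finrank ℝ E ∧
      (∀ c ∈ s, ‖c‖ ≤ 2) ∧ ∀ w : E, ∃ c ∈ s, ‖w‖ ≤ inner ℝ c w := by
  classical
  let Sep : Finset E → Prop := fun s =>
    (∀ c ∈ s, ‖c‖ ≤ 2) ∧ ∀ c ∈ s, ∀ d ∈ s, c ≠ d → 1 ≤ ‖c - d‖
  have hcard : ∀ s, Sep s → s.card ≤ 5 ^ Module.finrank ℝ E := fun s hs =>
    Besicovitch.card_le_of_separated s hs.1 hs.2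
  let cards : Set ℕ := {k | ∃ s, Sep s ∧ s.card = k}
  have hbdd : BddAbove cards := ⟨5 ^ Module.finrank ℝ E, by
    rintro _ ⟨s, hs, rfl⟩
    exact hcard s hs⟩
  have hne : cards.Nonempty := ⟨0, ∅, by simp [Sep], rfl⟩
  obtain ⟨s, hs, hmax⟩ := Nat.sSup_mem hne hbdd
  have hcover : ∀ x : E, ‖x‖ ≤ 2 → ∃ c ∈ s, ‖x - c‖ ≤ 1 := by
    intro x hx
    by_contra! hfar
    have hxs : x ∉ s := fun h => by
      have := hfar x h
      simp at this
      linarith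
    have hins : Sep (insert x s) := by
      refine ⟨fun c hc => ?_, fun c hc d hd hcd => ?_⟩
      · rcases Finset.mem_insert.1 hc with rfl | hc
        · exact hx
        · exact hs.1 c hc
      · rcases Finset.mem_insert.1 hc with rfl | hc' <;>
          rcases Finset.mem_insert.1 hd with rfl | hd'
        · exact absurd rfl hcd
        · exact (hfar d hd').le
        · rw [norm_sub_rev]
          exact (hfar c hc').le
        · exact hs.2 c hc' d hd' hcd
    have := le_csSup hbdd ⟨_, hins, rfl⟩
    rw [Finset.card_insert_of_notMem hxs, hmax] at this
    omega
  refine ⟨s, hcard s hs, hs.1, fun w => ?_⟩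
  by_cases hw : w = 0
  · obtain ⟨c, hc, -⟩ := hcover 0 (by simp)
    exact ⟨c, hc, by simp [hw]⟩
  have hw' : 0 < ‖w‖ := norm_pos_iff.2 hw
  -- The point `2 w / ‖w‖` pairs to `2 ‖w‖` with `w`, and the approximation costs at most `‖w‖`.
  obtain ⟨c, hc, hcw⟩ := hcover ((2 / ‖w‖) • w) (by
    rw [norm_smul, Real.norm_of_nonneg (by positivity), div_mul_cancel₀ _ hw'.ne'])
  refine ⟨c, hc, ?_⟩
  have h1 : inner ℝ ((2 / ‖w‖) • w - c) w ≤ ‖w‖ := by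
    refine (real_inner_le_norm _ _).trans ?_
    exact mul_le_of_le_one_left hw'.le hcw
  rw [inner_sub_left, real_inner_smul_left, real_inner_self_eq_norm_sq] at h1
  have h2 : 2 / ‖w‖ * ‖w‖ ^ 2 = 2 * ‖w‖ := by
    field_simp
  linarith

/-- A linear map has norm at most `q` if its bilinear form is at most `q` on norming sets. -/
lemma norm_apply_le_of_norming {E F : Type*} [NormedAddCommGroup E] [InnerProductSpace ℝ E]
    [FiniteDimensional ℝ E] [NormedAddCommGroup F] [InnerProductSpace ℝ F]
    [FiniteDimensional ℝ F] {s : Finset E} {t : Finset F}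
    (hs : ∀ w : E, ∃ c ∈ s, ‖w‖ ≤ inner ℝ c w) (ht : ∀ w : F, ∃ d ∈ t, ‖w‖ ≤ inner ℝ d w)
    (T : E →ₗ[ℝ] F) {q : ℝ} (hq : ∀ c ∈ s, ∀ d ∈ t, inner ℝ d (T c) ≤ q) (v : E) :
    ‖T v‖ ≤ q * ‖v‖ := by
  obtain ⟨d, hd, h⟩ := ht (T v)
  obtain ⟨c, hc, h'⟩ := hs (LinearMap.adjoint T d)
  rw [LinearMap.adjoint_inner_right, real_inner_comm] at h'
  rw [← LinearMap.adjoint_inner_left] at h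
  refine h.trans ((real_inner_le_norm _ _).trans ?_)
  gcongr
  exact h'.trans (hq c hc d hd)

/-- **Trace duality**: the pairing of two matrices is at most the trace norm of the one times any
bound for the operator norm of the other. -/
lemma abs_sum_mul_le_traceNorm_mul {ι κ : Type} [Fintype ι] [Fintype κ] [DecidableEq κ]
    (A X : Matrix ι κ ℝ) {q : ℝ}
    (hq : ∀ v, ‖Matrix.toEuclideanLin X v‖ ≤ q * ‖v‖) :
    |∑ a, ∑ c, A a c * X a c| ≤ traceNorm A * q := by
  classical
  set T := Matrix.toEuclideanLin A with hT
  set U := Matrix.toEuclideanLin X with hU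
  have hn : Module.finrank ℝ (EuclideanSpace ℝ κ) = Fintype.card κ := finrank_euclideanSpace
  set e := T.isSymmetric_adjoint_comp_self.eigenvectorBasis hn with he
  have htrace : ∀ {ν : Type} [Fintype ν] (b : OrthonormalBasis ν ℝ (EuclideanSpace ℝ κ)),
      LinearMap.trace ℝ _ (LinearMap.adjoint T ∘ₗ U) = ∑ i, inner ℝ (T (b i)) (U (b i)) := by
    intro ν _ b
    rw [LinearMap.trace_eq_sum_inner _ b]
    simp [LinearMap.adjoint_inner_right]
  have hsum : ∑ a, ∑ c, A a c * X a c = ∑ i, inner ℝ (T (e i)) (U (e i)) := by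
    rw [← htrace e, htrace (EuclideanSpace.basisFun κ ℝ), Finset.sum_comm]
    refine Finset.sum_congr rfl fun c _ => ?_
    simp [hT, hU, PiLp.inner_apply, Matrix.toLpLin_apply, mul_comm]
  have hnorm : ∀ i : Fin (Fintype.card κ), ‖T (e i)‖ = T.singularValues i := by
    intro i
    rw [← sq_eq_sq₀ (norm_nonneg _) (T.singularValues_nonneg _), T.sq_singularValues_fin hn,
      ← real_inner_self_eq_norm_sq, ← LinearMap.adjoint_inner_right]
    have := T.isSymmetric_adjoint_comp_self.apply_eigenvectorBasis hn i
    rw [LinearMap.comp_apply] at this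
    rw [he, this, inner_smul_right, real_inner_self_eq_norm_sq, OrthonormalBasis.norm_eq_one]
    simp
  have htn : traceNorm A = ∑ i : Fin (Fintype.card κ), T.singularValues i := by
    rw [Fin.sum_univ_eq_sum_range (fun i => T.singularValues i)]
    refine Finsupp.sum_of_support_subset _ (fun i hi => ?_) _ (fun _ _ => rfl)
    rw [Finset.mem_range]
    by_contra! h
    exact Finsupp.mem_support_iff.1 hi (T.singularValues_of_finrank_le (hn.trans_le h))
  rw [hsum, htn, Finset.sum_mul]
  refine (Finset.abs_sum_le_sum_abs _ _).trans (Finset.sum_le_sum fun i _ => ?_)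
  refine (abs_real_inner_le_norm _ _).trans ?_
  rw [hnorm]
  refine mul_le_mul_of_nonneg_left ((hq _).trans_eq ?_) (T.singularValues_nonneg _)
  rw [OrthonormalBasis.norm_eq_one, mul_one]

lemma traceNorm_nonneg {ι κ : Type} [Fintype ι] [Fintype κ] [DecidableEq κ] (A : Matrix ι κ ℝ) :
    0 ≤ traceNorm A :=
  Finset.sum_nonneg fun _ _ => LinearMap.singularValues_nonneg _ _

namespace Tensor

variable {K : ℕ} {n : Fin K → ℕ}

/-! ### The latent trace norm against Gaussian tensors -/

lemma dot_eq_sum_unfold (k : Fin K) (W X : Tensor n) :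
    dot W X = ∑ a, ∑ c, unfold k W a c * unfold k X a c := by
  rw [dot, ← (Equiv.piSplitAt k (fun j => Fin (n j))).symm.sum_comp, Fintype.sum_prod_type]
  rfl

/-- The tensor whose mode-`k` unfolding is the rank-one matrix `d cᵀ`. -/
noncomputable def rankOne (k : Fin K) (d : EuclideanSpace ℝ (Fin (n k)))
    (c : EuclideanSpace ℝ ((j : {j : Fin K // j ≠ k}) → Fin (n j))) : Tensor n :=
  fun i => d (Equiv.piSplitAt k (fun j => Fin (n j)) i).1 *
    c (Equiv.piSplitAt k (fun j => Fin (n j)) i).2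

lemma unfold_rankOne (k : Fin K) (d : EuclideanSpace ℝ (Fin (n k)))
    (c : EuclideanSpace ℝ ((j : {j : Fin K // j ≠ k}) → Fin (n j))) (a b) :
    unfold k (rankOne k d c) a b = d a * c b := by
  simp only [unfold, rankOne, Matrix.of_apply, Equiv.apply_symm_apply]

lemma dot_rankOne (k : Fin K) (d : EuclideanSpace ℝ (Fin (n k)))
    (c : EuclideanSpace ℝ ((j : {j : Fin K // j ≠ k}) → Fin (n j))) (X : Tensor n) :
    dot (rankOne k d c) X = inner ℝ d (Matrix.toEuclideanLin (unfold k X) c) := by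
  rw [dot_eq_sum_unfold k]
  simp only [unfold_rankOne, PiLp.inner_apply, Matrix.toLpLin_apply, Matrix.mulVec, dotProduct,
    RCLike.inner_apply, conj_trivial, Finset.sum_mul]
  exact Finset.sum_congr rfl fun _ _ => Finset.sum_congr rfl fun _ _ => by ring

lemma dot_rankOne_self (k : Fin K) (d : EuclideanSpace ℝ (Fin (n k)))
    (c : EuclideanSpace ℝ ((j : {j : Fin K // j ≠ k}) → Fin (n j))) :
    dot (rankOne k d c) (rankOne k d c) = ‖d‖ ^ 2 * ‖c‖ ^ 2 := by
  rw [dot_eq_sum_unfold k, EuclideanSpace.real_norm_sq_eq, EuclideanSpace.real_norm_sq_eq,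
    Finset.sum_mul_sum]
  simp only [unfold_rankOne]
  exact Finset.sum_congr rfl fun _ _ => Finset.sum_congr rfl fun _ _ => by ring

lemma sum_dot {ι : Type*} (s : Finset ι) (V : ι → Tensor n) (X : Tensor n) :
    dot (∑ k ∈ s, V k) X = ∑ k ∈ s, dot (V k) X := by
  simp only [dot, Finset.sum_apply, Finset.sum_mul]
  rw [Finset.sum_comm]

lemma latentNorm_nonneg (W : Tensor n) : 0 ≤ latentNorm W :=
  Real.iInf_nonneg fun _ => Finset.sum_nonneg fun _ _ => traceNorm_nonneg _

lemma abs_dot_le_latentNorm_mul (hK : 0 < K) {X : Tensor n} {q : ℝ} (hq0 : 0 ≤ q)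
    (hq : ∀ k v, ‖Matrix.toEuclideanLin (unfold k X) v‖ ≤ q * ‖v‖) (W : Tensor n) :
    |dot W X| ≤ latentNorm W * q := by
  have hne : Nonempty {V : Fin K → Tensor n // ∑ k, V k = W} :=
    ⟨⟨Pi.single ⟨0, hK⟩ W, by simp⟩⟩
  rw [latentNorm, Real.iInf_mul_of_nonneg hq0]
  refine le_ciInf fun V => ?_
  have hV : dot W X = ∑ k, dot (V.1 k) X := by rw [← sum_dot, V.2]
  rw [hV, Finset.sum_mul]
  refine (Finset.abs_sum_le_sum_abs _ _).trans (Finset.sum_le_sum fun k _ => ?_)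
  rw [dot_eq_sum_unfold k]
  exact abs_sum_mul_le_traceNorm_mul _ _ (hq k)

lemma sqrt_add_sqrt_le_dimFactor (n : Fin K → ℕ) (k : Fin K) :
    √(n k : ℝ) + √(∏ j ∈ Finset.univ.erase k, (n j : ℝ)) ≤ dimFactor n :=
  le_ciSup (f := fun k : Fin K => √(n k : ℝ) + √(∏ j ∈ Finset.univ.erase k, (n j : ℝ)))
    (Set.finite_range _).bddAbove k

lemma dimFactor_nonneg (n : Fin K → ℕ) : 0 ≤ dimFactor n :=
  Real.iSup_nonneg fun _ => by positivity

lemma five_pow_le_exp_dimFactor (n : Fin K → ℕ) (k : Fin K) :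
    (5 : ℝ) ^ (n k + ∏ j ∈ Finset.univ.erase k, n j) ≤ Real.exp (2 * dimFactor n ^ 2) := by
  have h5 : (5 : ℝ) ≤ Real.exp 2 := by
    have := Real.quadratic_le_exp_of_nonneg (x := 2) (by norm_num)
    norm_num at this
    exact this
  have h1 : ((n k + ∏ j ∈ Finset.univ.erase k, n j : ℕ) : ℝ) ≤ dimFactor n ^ 2 := by
    refine le_trans ?_ (pow_le_pow_left₀ (by positivity) (sqrt_add_sqrt_le_dimFactor n k) 2)
    rw [add_sq, Real.sq_sqrt (by positivity), Real.sq_sqrt (by positivity)]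
    push_cast
    have : 0 ≤ 2 * √(n k : ℝ) * √(∏ j ∈ Finset.univ.erase k, (n j : ℝ)) := by positivity
    linarith
  refine (pow_le_pow_left₀ (by norm_num) h5 _).trans ?_
  rw [← Real.exp_nat_mul]
  exact Real.exp_le_exp.2 (by linarith)

/-- A finite set of tensors of Frobenius norm at most `4` that is norming for the dual of the latent
trace norm, uniformly in the tensor of that norm. -/
lemma exists_norming_finset_latentNorm (hK : 0 < K) (n : Fin K → ℕ) :
    ∃ A : Finset (Tensor n), (A.card : ℝ) ≤ K * Real.exp (2 * dimFactor n ^ 2) ∧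
      (∀ a ∈ A, dot a a ≤ 16) ∧
      ∀ X : Tensor n, ∃ a ∈ A, 0 ≤ dot a X ∧
        ∀ W : Tensor n, |dot W X| ≤ latentNorm W * dot a X := by
  classical
  choose s hs_card hs_norm hs using fun k : Fin K =>
    exists_norming_finset (EuclideanSpace ℝ ((j : {j : Fin K // j ≠ k}) → Fin (n j)))
  choose t ht_card ht_norm ht using fun k : Fin K =>
    exists_norming_finset (EuclideanSpace ℝ (Fin (n k)))
  set A : Finset (Tensor n) := Finset.univ.biUnion fun k : Fin K =>
    (t k ×ˢ s k).image fun p => rankOne k p.1 p.2 with hA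
  have hmem : ∀ k, ∀ d ∈ t k, ∀ c ∈ s k, rankOne k d c ∈ A := by
    intro k d hd c hc
    simp only [hA, Finset.mem_biUnion, Finset.mem_univ, true_and, Finset.mem_image,
      Finset.mem_product]
    exact ⟨k, (d, c), ⟨hd, hc⟩, rfl⟩
  refine ⟨A, ?_, ?_, fun X => ?_⟩
  · have h1 : A.card ≤ ∑ k : Fin K, 5 ^ (n k + ∏ j ∈ Finset.univ.erase k, n j) := by
      refine Finset.card_biUnion_le.trans (Finset.sum_le_sum fun k _ => ?_)
      refine Finset.card_image_le.trans ?_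
      rw [Finset.card_product, pow_add]
      refine Nat.mul_le_mul ((ht_card k).trans_eq (by simp)) ((hs_card k).trans_eq ?_)
      rw [finrank_euclideanSpace, Fintype.card_pi]
      simp only [Fintype.card_fin]
      rw [← Finset.prod_subtype (Finset.univ.erase k) (by simp) n]
    calc (A.card : ℝ) ≤ ∑ k : Fin K, (5 : ℝ) ^ (n k + ∏ j ∈ Finset.univ.erase k, n j) := by
          exact_mod_cast h1
      _ ≤ ∑ _k : Fin K, Real.exp (2 * dimFactor n ^ 2) :=
          Finset.sum_le_sum fun k _ => five_pow_le_exp_dimFactor n k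
      _ = K * Real.exp (2 * dimFactor n ^ 2) := by simp
  · intro a ha
    simp only [hA, Finset.mem_biUnion, Finset.mem_univ, true_and, Finset.mem_image,
      Finset.mem_product] at ha
    obtain ⟨k, p, ⟨hd, hc⟩, rfl⟩ := ha
    rw [dot_rankOne_self]
    have h1 := pow_le_pow_left₀ (norm_nonneg _) (ht_norm k _ hd) 2
    have h2 := pow_le_pow_left₀ (norm_nonneg _) (hs_norm k _ hc) 2
    calc ‖p.1‖ ^ 2 * ‖p.2‖ ^ 2 ≤ 2 ^ 2 * 2 ^ 2 := by gcongr
      _ = 16 := by norm_num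
  · have hex : ∀ k, ∃ d ∈ t k, ∃ c ∈ s k, 0 ≤ dot (rankOne k d c) X := by
      intro k
      obtain ⟨d, hd, -⟩ := ht k 0
      obtain ⟨c, hc, h⟩ := hs k (LinearMap.adjoint (Matrix.toEuclideanLin (unfold k X)) d)
      refine ⟨d, hd, c, hc, ?_⟩
      rw [dot_rankOne]
      rw [LinearMap.adjoint_inner_right, real_inner_comm] at h
      exact (norm_nonneg _).trans h
    obtain ⟨d, hd, c, hc, h0⟩ := hex ⟨0, hK⟩
    obtain ⟨a, ha, hmax⟩ := A.exists_max_image (fun a => dot a X) ⟨_, hmem _ d hd c hc⟩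
    have ha0 : 0 ≤ dot a X := h0.trans (hmax _ (hmem _ d hd c hc))
    refine ⟨a, ha, ha0, abs_dot_le_latentNorm_mul hK ha0 fun k =>
      norm_apply_le_of_norming (hs k) (ht k) _ fun c hc d hd => ?_⟩
    rw [← dot_rankOne]
    exact hmax _ (hmem k d hd c hc)

end Tensor

/-! ### Gaussian exponential moments -/

lemma lintegral_exp_sum_pi {ι Ω : Type*} [Fintype ι] [MeasurableSpace Ω] {μ : ι → Measure Ω}
    [∀ i, SigmaFinite (μ i)] {f : ι → Ω → ℝ}
    (hf : ∀ i, Integrable (fun x => Real.exp (f i x)) (μ i)) :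
    ∫⁻ x, ENNReal.ofReal (Real.exp (∑ i, f i (x i))) ∂(Measure.pi μ) =
      ENNReal.ofReal (∏ i, ∫ x, Real.exp (f i x) ∂(μ i)) := by
  simp only [Real.exp_sum]
  rw [← ofReal_integral_eq_lintegral_ofReal (Integrable.fintype_prod hf)
    (Filter.Eventually.of_forall fun _ => Finset.prod_nonneg fun _ _ => (Real.exp_pos _).le),
    integral_fintype_prod_eq_prod (fun i x => Real.exp (f i x))]

namespace Tensor

variable {K : ℕ} {n : Fin K → ℕ}

lemma continuous_dot_left (X : Tensor n) : Continuous fun W : Tensor n => dot W X := by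
  unfold dot
  fun_prop

lemma measurable_dot (W : Tensor n) : Measurable fun X : Tensor n => dot W X := by
  unfold dot
  fun_prop

lemma sub_dot (W V X : Tensor n) : dot (W - V) X = dot W X - dot V X := by
  simp [dot, sub_mul, Finset.sum_sub_distrib]

lemma dot_neg (W X : Tensor n) : dot W (-X) = -dot W X := by
  simp [dot]

lemma dot_smul_sum {ι : Type*} (s : Finset ι) (W : Tensor n) (c : ℝ) (X : ι → Tensor n) :
    dot W (c • ∑ i ∈ s, X i) = ∑ i ∈ s, c * dot W (X i) := by
  simp only [dot, Pi.smul_apply, Finset.sum_apply, smul_eq_mul, Finset.mul_sum]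
  rw [Finset.sum_comm]
  exact Finset.sum_congr rfl fun _ _ => Finset.sum_congr rfl fun _ _ => by ring

lemma mul_dot_eq_sum (c : ℝ) (W X : Tensor n) : c * dot W X = ∑ i, (c * W i) * X i := by
  simp only [dot, Finset.mul_sum, mul_assoc]

lemma integral_exp_mul_gaussianReal (t : ℝ) :
    ∫ x, Real.exp (t * x) ∂(gaussianReal 0 1) = Real.exp (t ^ 2 / 2) := by
  have := congrFun (mgf_fun_id_gaussianReal (μ := 0) (v := 1)) t
  simpa [mgf] using this

lemma integrable_exp_mul_dot_stdGaussian (c : ℝ) (W : Tensor n) :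
    Integrable (fun X => Real.exp (c * dot W X)) (stdGaussian n) := by
  have := Integrable.fintype_prod (μ := fun _ : (j : Fin K) → Fin (n j) => gaussianReal 0 1)
    (f := fun i x => Real.exp ((c * W i) * x)) (fun i => integrable_exp_mul_gaussianReal _)
  simp only [← Real.exp_sum] at this
  simp only [mul_dot_eq_sum]
  exact this

lemma integral_exp_mul_dot_stdGaussian (c : ℝ) (W : Tensor n) :
    ∫ X, Real.exp (c * dot W X) ∂(stdGaussian n) = Real.exp (c ^ 2 * dot W W / 2) := by
  have := integral_fintype_prod_eq_prod (μ := fun _ : (j : Fin K) → Fin (n j) => gaussianReal 0 1)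
    (f := fun i x => Real.exp ((c * W i) * x))
  simp only [← Real.exp_sum, integral_exp_mul_gaussianReal] at this
  simp only [mul_dot_eq_sum]
  refine this.trans ?_
  rw [Finset.sum_div]
  exact congrArg _ (Finset.sum_congr rfl fun _ _ => by ring)

lemma measurePreserving_neg_stdGaussian :
    MeasurePreserving (fun X : Tensor n => -X) (stdGaussian n) (stdGaussian n) :=
  measurePreserving_pi _ _ fun _ => ⟨measurable_neg,
    gaussianReal_map_neg.trans (by rw [neg_zero])⟩

lemma integrable_apply_stdGaussian (i : (j : Fin K) → Fin (n j)) :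
    Integrable (fun X : Tensor n => X i) (stdGaussian n) := by
  have h : Integrable (fun x : ℝ => x) (gaussianReal 0 1) :=
    (memLp_id_gaussianReal 1).integrable le_rfl
  exact (measurePreserving_eval (fun _ : (j : Fin K) → Fin (n j) => gaussianReal 0 1)
    i).integrable_comp_of_integrable h

/-! ### The loss increments -/

/-- The excess loss of `W` over `W₀`, set to `0` off a set `Z` of sample points on which the loss
is well behaved. -/
noncomputable def excessLoss (l : ℝ → ℝ → ℝ) (Z : Set (Tensor n × ℝ)) (W₀ W : Tensor n) :
    Tensor n × ℝ → ℝ :=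
  Z.indicator fun p => l (dot W p.1) p.2 - l (dot W₀ p.1) p.2

/-- The expected excess loss of `W` over `W₀` minus the empirical one. -/
noncomputable def excessDeviation (l : ℝ → ℝ → ℝ) (Z : Set (Tensor n × ℝ))
    (μ : Measure (Tensor n × ℝ)) (W₀ W : Tensor n) {m : ℕ} (S : Fin m → Tensor n × ℝ) : ℝ :=
  ∫ p, excessLoss l Z W₀ W p ∂μ - (1 / (m : ℝ)) * ∑ i, excessLoss l Z W₀ W (S i)

variable {l : ℝ → ℝ → ℝ} {Z : Set (Tensor n × ℝ)} {μ : Measure (Tensor n × ℝ)} {W₀ : Tensor n}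
  {Λ : ℝ≥0} {m : ℕ}

lemma measurable_excessLoss (hl : Measurable (Function.uncurry l)) (hZ : MeasurableSet Z)
    (W : Tensor n) : Measurable (excessLoss l Z W₀ W) := by
  have h : ∀ V : Tensor n, Measurable fun p : Tensor n × ℝ => l (dot V p.1) p.2 := fun V =>
    hl.comp (((measurable_dot V).comp measurable_fst).prodMk measurable_snd)
  exact ((h W).sub (h W₀)).indicator hZ

lemma measurable_excessDeviation (hl : Measurable (Function.uncurry l)) (hZ : MeasurableSet Z)
    (W : Tensor n) :
    Measurable fun S : Fin m → Tensor n × ℝ => excessDeviation l Z μ W₀ W S :=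
  measurable_const.sub ((Finset.measurable_sum _ fun i _ =>
    (measurable_excessLoss hl hZ W).comp (measurable_pi_apply i)).const_mul _)

lemma abs_excessLoss_sub_le (hL : ∀ p ∈ Z, LipschitzWith Λ fun z => l z p.2) (W V : Tensor n)
    (p : Tensor n × ℝ) :
    |excessLoss l Z W₀ W p - excessLoss l Z W₀ V p| ≤ Λ * |dot W p.1 - dot V p.1| := by
  by_cases hp : p ∈ Z
  · simp only [excessLoss, Set.indicator_of_mem hp, sub_sub_sub_cancel_right]
    exact (hL p hp).dist_le_mul _ _
  · simp only [excessLoss, Set.indicator_of_notMem hp, sub_zero, abs_zero]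
    positivity

lemma excessLoss_self (p : Tensor n × ℝ) : excessLoss l Z W₀ W₀ p = 0 := by
  simp [excessLoss]

lemma abs_excessLoss_le (hL : ∀ p ∈ Z, LipschitzWith Λ fun z => l z p.2) (W : Tensor n)
    (p : Tensor n × ℝ) : |excessLoss l Z W₀ W p| ≤ Λ * |dot W p.1 - dot W₀ p.1| := by
  have := abs_excessLoss_sub_le (W₀ := W₀) hL W W₀ p
  rwa [excessLoss_self, sub_zero] at this

lemma integrable_excessLoss (hZ : MeasurableSet Z)
    (hi : ∀ W : Tensor n, Integrable (fun p : Tensor n × ℝ => l (dot W p.1) p.2) μ)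
    (W : Tensor n) : Integrable (excessLoss l Z W₀ W) μ :=
  ((hi W).sub (hi W₀)).indicator hZ

lemma integral_excessLoss (hZμ : ∀ᵐ p ∂μ, p ∈ Z)
    (hi : ∀ W : Tensor n, Integrable (fun p : Tensor n × ℝ => l (dot W p.1) p.2) μ)
    (W : Tensor n) : ∫ p, excessLoss l Z W₀ W p ∂μ = risk l μ W - risk l μ W₀ := by
  rw [risk, risk, ← integral_sub (hi W) (hi W₀)]
  refine integral_congr_ae ?_
  filter_upwards [hZμ] with p hp
  simp [excessLoss, Set.indicator_of_mem hp]

lemma sum_excessLoss {S : Fin m → Tensor n × ℝ} (hS : ∀ i, S i ∈ Z) (W : Tensor n) :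
    (1 / (m : ℝ)) * ∑ i, excessLoss l Z W₀ W (S i) = empRisk l S W - empRisk l S W₀ := by
  rw [empRisk, empRisk, ← mul_sub, ← Finset.sum_sub_distrib]
  simp [excessLoss, Set.indicator_of_mem (hS _)]

lemma continuous_excessLoss (hL : ∀ p ∈ Z, LipschitzWith Λ fun z => l z p.2)
    (p : Tensor n × ℝ) : Continuous fun W => excessLoss l Z W₀ W p := by
  by_cases hp : p ∈ Z
  · simp only [excessLoss, Set.indicator_of_mem hp]
    exact ((hL p hp).continuous.comp (continuous_dot_left p.1)).sub continuous_const
  · simp only [excessLoss, Set.indicator_of_notMem hp]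
    exact continuous_const

/-- The expected excess loss is Lipschitz, since the coordinates of the tensor are integrable. -/
lemma continuous_integral_excessLoss (hμ : μ.fst = stdGaussian n) (hZ : MeasurableSet Z)
    (hL : ∀ p ∈ Z, LipschitzWith Λ fun z => l z p.2)
    (hi : ∀ W : Tensor n, Integrable (fun p : Tensor n × ℝ => l (dot W p.1) p.2) μ) :
    Continuous fun W => ∫ p, excessLoss l Z W₀ W p ∂μ := by
  have hX : ∀ i, Integrable (fun p : Tensor n × ℝ => |p.1 i|) μ := by
    intro i
    have h := (integrable_apply_stdGaussian (n := n) i).abs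
    rw [← hμ] at h
    exact h.comp_measurable measurable_fst
  have hsum : Integrable (fun p : Tensor n × ℝ => ∑ i, |p.1 i|) μ :=
    integrable_finsetSum _ fun i _ => hX i
  have hC : 0 ≤ ∫ p, (∑ i, |p.1 i|) ∂μ := integral_nonneg fun p => by positivity
  refine (LipschitzWith.of_dist_le_mul (K := Λ * (∫ p, (∑ i, |p.1 i|) ∂μ).toNNReal)
    fun W V => ?_).continuous
  rw [Real.dist_eq, ← integral_sub (integrable_excessLoss hZ hi W) (integrable_excessLoss hZ hi V)]
  refine abs_integral_le_integral_abs.trans ?_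
  rw [NNReal.coe_mul, Real.coe_toNNReal _ hC, mul_right_comm, ← integral_const_mul]
  refine integral_mono
    ((integrable_excessLoss hZ hi W).sub (integrable_excessLoss hZ hi V)).abs
    (hsum.const_mul _) fun p => ?_
  refine (abs_excessLoss_sub_le hL W V p).trans ?_
  rw [mul_assoc, ← sub_dot, dot, Finset.mul_sum]
  gcongr
  refine (Finset.abs_sum_le_sum_abs _ _).trans (Finset.sum_le_sum fun i _ => ?_)
  rw [abs_mul]
  gcongr
  exact dist_le_pi_dist W V i

/-! ### Exponential moments of the deviations -/

lemma lintegral_exp_sum_dot_le [IsProbabilityMeasure μ] (hμ : μ.fst = stdGaussian n) (m : ℕ)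
    {a : Tensor n} (ha : dot a a ≤ 16) (c : ℝ) :
    ∫⁻ S, ENNReal.ofReal (Real.exp (∑ i, c * dot a (S i).1)) ∂(Measure.pi fun _ : Fin m => μ) ≤
      ENNReal.ofReal (Real.exp (m * (8 * c ^ 2))) := by
  have hint : Integrable (fun p : Tensor n × ℝ => Real.exp (c * dot a p.1)) μ := by
    have := integrable_exp_mul_dot_stdGaussian c a
    rw [← hμ] at this
    exact this.comp_measurable measurable_fst
  have hval : ∫ p : Tensor n × ℝ, Real.exp (c * dot a p.1) ∂μ =
      Real.exp (c ^ 2 * dot a a / 2) := by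
    rw [← integral_exp_mul_dot_stdGaussian, ← hμ, Measure.fst, integral_map
      measurable_fst.aemeasurable
      ((measurable_dot a).const_mul c).exp.aestronglyMeasurable]
  refine (lintegral_exp_sum_pi (μ := fun _ : Fin m => μ)
    (f := fun _ p => c * dot a p.1) fun _ => hint).trans_le (ENNReal.ofReal_le_ofReal ?_)
  rw [hval, Finset.prod_const, Finset.card_univ, Fintype.card_fin, ← Real.exp_nat_mul]
  refine Real.exp_le_exp.2 (mul_le_mul_of_nonneg_left ?_ (Nat.cast_nonneg m))
  have := mul_le_mul_of_nonneg_left ha (sq_nonneg c)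
  linarith

/-- The deviations, uniformly over a countable part of the ball of the latent trace norm, are
sub-Gaussian up to the entropy `log K + 2 * dimFactor n ^ 2` of the norming set. -/
lemma lintegral_expSup_excessDeviation_le [IsProbabilityMeasure μ] (hK : 0 < K) (hm : 0 < m)
    (hμ : μ.fst = stdGaussian n) (hl : Measurable (Function.uncurry l)) (hZ : MeasurableSet Z)
    (hL : ∀ p ∈ Z, LipschitzWith Λ fun z => l z p.2)
    (hi : ∀ W : Tensor n, Integrable (fun p : Tensor n × ℝ => l (dot W p.1) p.2) μ)
    {B₀ : ℝ} (hW₀ : latentNorm W₀ ≤ B₀) {ι : Type*} [Countable ι] [Nonempty ι]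
    {W : ι → Tensor n} (hW : ∀ j, latentNorm (W j) ≤ B₀) {t : ℝ} (ht : 0 < t) :
    ∫⁻ S, expSup (fun j => t * excessDeviation l Z μ W₀ (W j) S)
        ∂(Measure.pi fun _ : Fin m => μ) ≤
      ENNReal.ofReal (Real.exp ((Real.log K + 2 * dimFactor n ^ 2) +
        t ^ 2 * (16 * Λ * B₀ / √m) ^ 2 / 2)) := by
  obtain ⟨A, hAcard, hA16, hA⟩ := exists_norming_finset_latentNorm hK n
  have hm' : (0 : ℝ) < m := by exact_mod_cast hm
  have hB₀ : 0 ≤ B₀ := (latentNorm_nonneg _).trans hW₀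
  have hΛ : (0 : ℝ) ≤ Λ := Λ.2
  set θ : ℝ := t / m with hθ
  have hθ0 : 0 < θ := by positivity
  set c : ℝ := 4 * θ * Λ * B₀ with hc
  set h : ι → Tensor n × ℝ → ℝ := fun j p => θ * excessLoss l Z W₀ (W j) p with hh
  set s : ι → Tensor n × ℝ → ℝ := fun j p => (2 * θ * Λ) * dot (W j - W₀) p.1 with hs
  have hsm : ∀ j, Measurable (s j) := fun j =>
    ((measurable_dot _).comp measurable_fst).const_mul _
  have hsymm : ∀ a : ι → ℝ, ∫⁻ z, expSup (fun j => a j - s j z) ∂μ =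
      ∫⁻ z, expSup (fun j => a j + s j z) ∂μ := by
    intro a
    have hg : Measurable fun X : Tensor n =>
        expSup (fun j => a j + (2 * θ * Λ) * dot (W j - W₀) X) :=
      measurable_expSup fun j => measurable_const.add ((measurable_dot _).const_mul _)
    have hg' : Measurable fun X : Tensor n =>
        expSup (fun j => a j - (2 * θ * Λ) * dot (W j - W₀) X) :=
      measurable_expSup fun j => measurable_const.sub ((measurable_dot _).const_mul _)
    have e1 := lintegral_map (μ := μ) hg measurable_fst
    have e2 := lintegral_map (μ := μ) hg' measurable_fst
    rw [← Measure.fst, hμ] at e1 e2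
    rw [← e1, ← e2, ← measurePreserving_neg_stdGaussian.lintegral_comp hg]
    simp only [dot_neg, mul_neg, ← sub_eq_add_neg]
  have h0 : ∀ j z, |2 * h j z| ≤ |s j z| := by
    intro j z
    have := abs_excessLoss_le (W₀ := W₀) hL (W j) z
    simp only [hh, hs, sub_dot]
    rw [abs_mul, abs_mul, abs_mul, abs_of_pos hθ0, abs_of_pos (two_pos : (0 : ℝ) < 2),
      abs_of_nonneg (by positivity : 0 ≤ 2 * θ * (Λ : ℝ))]
    calc 2 * (θ * |excessLoss l Z W₀ (W j) z|)
        ≤ 2 * (θ * (Λ * |dot (W j) z.1 - dot W₀ z.1|)) := by gcongr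
      _ = _ := by ring
  have hLip : ∀ j k z, |2 * h j z - 2 * h k z| ≤ |s j z - s k z| := by
    intro j k z
    have := abs_excessLoss_sub_le (W₀ := W₀) hL (W j) (W k) z
    have e1 : 2 * h j z - 2 * h k z =
        (2 * θ) * (excessLoss l Z W₀ (W j) z - excessLoss l Z W₀ (W k) z) := by
      simp only [hh]; ring
    have e2 : s j z - s k z = (2 * θ * Λ) * (dot (W j) z.1 - dot (W k) z.1) := by
      simp only [hs, sub_dot]; ring
    rw [e1, e2, abs_mul (2 * θ), abs_mul (2 * θ * Λ), abs_of_nonneg (by positivity : 0 ≤ 2 * θ),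
      abs_of_nonneg (by positivity : 0 ≤ 2 * θ * (Λ : ℝ)), mul_assoc (2 * θ)]
    gcongr
  have hdev : ∀ (S : Fin m → Tensor n × ℝ) j, t * excessDeviation l Z μ W₀ (W j) S =
      0 + ∑ i, (∫ w, h j w ∂μ - h j (S i)) := by
    intro S j
    simp only [hh, excessDeviation, Finset.sum_sub_distrib, integral_const_mul,
      Finset.sum_const, Finset.card_univ, Fintype.card_fin, nsmul_eq_mul, ← Finset.mul_sum]
    rw [hθ]
    field_simp
    ring
  simp only [hdev]
  refine (lintegral_expSup_sum_le (fun j => (measurable_excessLoss hl hZ _).const_mul θ)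
    (fun j => (integrable_excessLoss hZ hi _).const_mul θ) hsm h0 hLip hsymm m
    (fun _ => 0)).trans ?_
  calc ∫⁻ S, expSup (fun j => 0 + ∑ i, s j (S i)) ∂(Measure.pi fun _ : Fin m => μ)
      ≤ ∫⁻ S, ∑ a ∈ A, ENNReal.ofReal (Real.exp (∑ i, c * dot a (S i).1))
          ∂(Measure.pi fun _ : Fin m => μ) := by
        refine lintegral_mono fun S => expSup_le_sum_of_forall_exists A _
          (fun a => ∑ i, c * dot a (S i).1) ?_
        obtain ⟨a, ha, ha0, haW⟩ := hA ((2 * θ * Λ) • ∑ i, (S i).1)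
        refine ⟨a, ha, fun j => ?_⟩
        rw [zero_add]
        simp only [hs, ← dot_smul_sum]
        have h1 := (le_abs_self _).trans (haW (W j))
        have h2 := (neg_abs_le _).trans' (neg_le_neg (haW W₀))
        have h3 := mul_le_mul_of_nonneg_right (hW j) ha0
        have h4 := mul_le_mul_of_nonneg_right hW₀ ha0
        have h5 : dot a (c • ∑ i, (S i).1) =
            2 * B₀ * dot a ((2 * θ * Λ) • ∑ i, (S i).1) := by
          rw [dot_smul_sum, dot_smul_sum, Finset.mul_sum]
          exact Finset.sum_congr rfl fun _ _ => by rw [hc]; ring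
        rw [h5, sub_dot]
        linarith
    _ = ∑ a ∈ A, ∫⁻ S, ENNReal.ofReal (Real.exp (∑ i, c * dot a (S i).1))
          ∂(Measure.pi fun _ : Fin m => μ) := by
        refine lintegral_finsetSum _ fun a _ => ?_
        exact (Finset.measurable_sum _ fun i _ => ((measurable_dot a).comp
          (measurable_fst.comp (measurable_pi_apply i))).const_mul c).exp.ennreal_ofReal
    _ ≤ A.card * ENNReal.ofReal (Real.exp (m * (8 * c ^ 2))) := by
        refine (Finset.sum_le_sum fun a ha =>
          lintegral_exp_sum_dot_le hμ m (hA16 a ha) c).trans_eq ?_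
        simp
    _ = ENNReal.ofReal (A.card * Real.exp (m * (8 * c ^ 2))) := by
        rw [ENNReal.ofReal_mul (by positivity), ENNReal.ofReal_natCast]
    _ ≤ _ := by
        refine ENNReal.ofReal_le_ofReal ?_
        rw [Real.exp_add, Real.exp_add, Real.exp_log (by exact_mod_cast hK)]
        refine (mul_le_mul_of_nonneg_right hAcard (Real.exp_pos _).le).trans_eq ?_
        congr 2
        rw [div_pow, Real.sq_sqrt hm'.le, hc, hθ]
        field_simp
        ring

/-! ### From deviations to excess risk -/

lemma ExcessRiskLeWithProb.mono {B₀ b b' δ : ℝ} (h : ExcessRiskLeWithProb l μ m B₀ W₀ b δ)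
    (hb : b ≤ b') : ExcessRiskLeWithProb l μ m B₀ W₀ b' δ := by
  obtain ⟨E, hE, hP, hS⟩ := h
  exact ⟨E, hE, hP, fun S hSE V hV => (hS S hSE V hV).trans hb⟩

/-- A bound for the deviations over a dense sequence of the ball bounds the excess risk of
every empirical risk minimizer, because the deviation is continuous in the tensor. -/
lemma excessRiskLeWithProb_of_excessDeviation [IsProbabilityMeasure μ]
    (hμ : μ.fst = stdGaussian n) (hl : Measurable (Function.uncurry l)) (hZ : MeasurableSet Z)
    (hZμ : ∀ᵐ p ∂μ, p ∈ Z) (hL : ∀ p ∈ Z, LipschitzWith Λ fun z => l z p.2)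
    (hi : ∀ W : Tensor n, Integrable (fun p : Tensor n × ℝ => l (dot W p.1) p.2) μ)
    {B₀ : ℝ} (hW₀ : latentNorm W₀ ≤ B₀) {W : ℕ → {W : Tensor n // latentNorm W ≤ B₀}}
    (hW : DenseRange W) {b δ : ℝ} (hδ : 0 ≤ δ)
    (hb : Measure.pi (fun _ : Fin m => μ) {S | ∃ j, b < excessDeviation l Z μ W₀ (W j) S} ≤
      ENNReal.ofReal δ) :
    ExcessRiskLeWithProb l μ m B₀ W₀ b δ := by
  set P := Measure.pi (fun _ : Fin m => μ) with hP
  have hmeas : MeasurableSet {S : Fin m → Tensor n × ℝ |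
      ∃ j, b < excessDeviation l Z μ W₀ (W j) S} := by
    rw [Set.ofPred_exists]
    exact MeasurableSet.iUnion fun j =>
      measurableSet_lt measurable_const (measurable_excessDeviation hl hZ _)
  have hZm : MeasurableSet {S : Fin m → Tensor n × ℝ | ∀ i, S i ∈ Z} := by
    rw [Set.ofPred_forall]
    exact MeasurableSet.iInter fun i => measurable_pi_apply i hZ
  have hZP : ∀ᵐ S ∂P, ∀ i, S i ∈ Z := by
    refine ae_all_iff.2 fun i => ?_
    exact (Measure.quasiMeasurePreserving_eval (μ := fun _ : Fin m => μ) i).ae hZμ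
  refine ⟨{S | ∀ i, S i ∈ Z} ∩ {S | ∃ j, b < excessDeviation l Z μ W₀ (W j) S}ᶜ,
    hZm.inter hmeas.compl, ?_, ?_⟩
  · rw [← hP, Measure.measure_inter_eq_of_ae (t := {S : Fin m → Tensor n × ℝ | ∀ i, S i ∈ Z}) hZP,
      prob_compl_eq_one_sub hmeas, ENNReal.ofReal_sub _ hδ, ENNReal.ofReal_one]
    exact tsub_le_tsub_left hb _
  · rintro S ⟨hSZ, hSb⟩ V ⟨hV, hVmin⟩
    have hcont : Continuous fun V : Tensor n => excessDeviation l Z μ W₀ V S :=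
      (continuous_integral_excessLoss hμ hZ hL hi).sub
        (continuous_const.mul (continuous_finsetSum _ fun i _ => continuous_excessLoss hL _))
    have hdev : excessDeviation l Z μ W₀ V S ≤ b :=
      hW.induction_on (p := fun V => excessDeviation l Z μ W₀ V.1 S ≤ b) ⟨V, hV⟩
        (isClosed_le (hcont.comp continuous_subtype_val) continuous_const)
        (fun j => not_lt.1 fun h => hSb ⟨j, h⟩)
    rw [excessDeviation, integral_excessLoss hZμ hi, sum_excessLoss hSZ] at hdev
    linarith [hVmin W₀ hW₀]

end Tensor

namespace Tensor

variable {K : ℕ} {n : Fin K → ℕ} {l : ℝ → ℝ → ℝ} {Z : Set (Tensor n × ℝ)}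
  {μ : Measure (Tensor n × ℝ)} {W₀ : Tensor n} {m : ℕ}

/-! ### Losses with values in the unit interval -/

lemma abs_excessLoss_le_one (h01 : ∀ p ∈ Z, ∀ z, l z p.2 ∈ Set.Icc (0 : ℝ) 1) (W : Tensor n)
    (p : Tensor n × ℝ) : |excessLoss l Z W₀ W p| ≤ 1 := by
  by_cases hp : p ∈ Z
  · simp only [excessLoss, Set.indicator_of_mem hp]
    have h1 := h01 p hp (dot W p.1)
    have h2 := h01 p hp (dot W₀ p.1)
    exact abs_le.2 ⟨by linarith [h1.1, h2.2], by linarith [h1.2, h2.1]⟩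
  · simp [excessLoss, Set.indicator_of_notMem hp]

lemma abs_excessDeviation_le [IsProbabilityMeasure μ] (hm : 0 < m)
    (h01 : ∀ p ∈ Z, ∀ z, l z p.2 ∈ Set.Icc (0 : ℝ) 1) (W : Tensor n)
    (S : Fin m → Tensor n × ℝ) : |excessDeviation l Z μ W₀ W S| ≤ 2 := by
  have hm' : (0 : ℝ) < m := by exact_mod_cast hm
  have h1 : |∫ p, excessLoss l Z W₀ W p ∂μ| ≤ 1 := by
    have := norm_integral_le_of_norm_le_const (μ := μ) (f := excessLoss l Z W₀ W)
      (Filter.Eventually.of_forall fun p => abs_excessLoss_le_one h01 W p)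
    simpa using this
  have h2 : |∑ i, excessLoss l Z W₀ W (S i)| ≤ m := by
    refine (Finset.abs_sum_le_sum_abs _ _).trans ?_
    refine (Finset.sum_le_sum fun i _ => abs_excessLoss_le_one h01 W (S i)).trans_eq ?_
    simp
  rw [excessDeviation]
  refine (abs_sub _ _).trans ?_
  rw [abs_mul, abs_of_nonneg (by positivity : 0 ≤ 1 / (m : ℝ))]
  have h3 : 1 / (m : ℝ) * |∑ i, excessLoss l Z W₀ W (S i)| ≤ 1 := by
    rw [one_div, inv_mul_le_iff₀ hm', mul_one]
    exact h2
  linarith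

lemma excessDeviation_update_sub_le
    (h01 : ∀ p ∈ Z, ∀ z, l z p.2 ∈ Set.Icc (0 : ℝ) 1) (W : Tensor n)
    (S : Fin m → Tensor n × ℝ) (i : Fin m) (z w : Tensor n × ℝ) :
    excessDeviation l Z μ W₀ W (Function.update S i z) ≤
      excessDeviation l Z μ W₀ W (Function.update S i w) + 2 / m := by
  have e : ∀ z, ∑ i', excessLoss l Z W₀ W (Function.update S i z i') =
      excessLoss l Z W₀ W z + ∑ i' ∈ Finset.univ.erase i, excessLoss l Z W₀ W (S i') := by
    intro z
    rw [← Finset.add_sum_erase _ _ (Finset.mem_univ i), Function.update_self]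
    congr 1
    refine Finset.sum_congr rfl fun j hj => ?_
    rw [Function.update_of_ne (Finset.ne_of_mem_erase hj)]
  have hz := (abs_le.1 (abs_excessLoss_le_one (W₀ := W₀) h01 W z)).1
  have hw := (abs_le.1 (abs_excessLoss_le_one (W₀ := W₀) h01 W w)).2
  have h := mul_le_mul_of_nonneg_left (by linarith :
    excessLoss l Z W₀ W w - excessLoss l Z W₀ W z ≤ 2) (by positivity : 0 ≤ 1 / (m : ℝ))
  rw [excessDeviation, excessDeviation, e, e]
  have h2 : 2 / (m : ℝ) = 1 / m * 2 := by ring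
  rw [h2]
  linarith

/-- For losses with values in `[0, 1]`, the supremum of the deviations has bounded differences, and
its mean is controlled by its exponential moments. -/
lemma measure_exists_lt_excessDeviation_le [IsProbabilityMeasure μ] (hm : 0 < m)
    (hl : Measurable (Function.uncurry l)) (hZ : MeasurableSet Z)
    (h01 : ∀ p ∈ Z, ∀ z, l z p.2 ∈ Set.Icc (0 : ℝ) 1) {ι : Type*} [Countable ι] [Nonempty ι]
    {W : ι → Tensor n} {L σ : ℝ} (hL : 0 ≤ L) (hσ : 0 ≤ σ)
    (h : ∀ t : ℝ, 0 < t → ∫⁻ S, expSup (fun j => t * excessDeviation l Z μ W₀ (W j) S)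
        ∂(Measure.pi fun _ : Fin m => μ) ≤ ENNReal.ofReal (Real.exp (L + t ^ 2 * σ ^ 2 / 2)))
    {δ : ℝ} (hδ : 0 < δ) (hδ1 : δ < 1) :
    Measure.pi (fun _ : Fin m => μ) {S | ∃ j, σ * √(2 * L) + 1 / √m * √(2 * Real.log (1 / δ)) <
      excessDeviation l Z μ W₀ (W j) S} ≤ ENNReal.ofReal δ := by
  set P := Measure.pi (fun _ : Fin m => μ) with hP
  have hm' : (0 : ℝ) < m := by exact_mod_cast hm
  set F : (Fin m → Tensor n × ℝ) → ℝ := fun S => ⨆ j, excessDeviation l Z μ W₀ (W j) S with hF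
  have habs : ∀ S j, |excessDeviation l Z μ W₀ (W j) S| ≤ 2 := fun S j =>
    abs_excessDeviation_le hm h01 _ _
  have hbdd : ∀ S, BddAbove (Set.range fun j => excessDeviation l Z μ W₀ (W j) S) := fun S =>
    ⟨2, by rintro _ ⟨j, rfl⟩; exact (abs_le.1 (habs S j)).2⟩
  have hFm : Measurable F := Measurable.iSup fun j => measurable_excessDeviation hl hZ _
  have hF2 : ∀ S, |F S| ≤ 2 := fun S => by
    obtain ⟨j⟩ := ‹Nonempty ι›
    exact abs_le.2 ⟨(abs_le.1 (habs S j)).1.trans (le_ciSup (hbdd S) j),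
      ciSup_le fun j => (abs_le.1 (habs S j)).2⟩
  have hFi : Integrable F P := Integrable.of_bound hFm.aestronglyMeasurable 2
    (Filter.Eventually.of_forall hF2)
  have hmean : ∫ S, F S ∂P ≤ σ * √(2 * L) := by
    refine le_mul_sqrt_of_forall_mul_le hL hσ fun t ht => ?_
    rw [← Real.exp_le_exp, ← ENNReal.ofReal_le_ofReal_iff (Real.exp_pos _).le]
    refine le_trans ?_ (h t ht)
    rw [← integral_const_mul]
    refine (ofReal_exp_integral_le (hFi.const_mul t)).trans (lintegral_mono fun S => ?_)
    rw [hF, Real.mul_iSup_of_nonneg ht.le]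
    refine ofReal_exp_iSup_le_expSup ⟨t * 2, ?_⟩
    rintro _ ⟨j, rfl⟩
    exact mul_le_mul_of_nonneg_left (abs_le.1 (habs S j)).2 ht.le
  have hdiff : ∀ S i z w, F (Function.update S i z) - F (Function.update S i w) ≤ 2 / m := by
    intro S i z w
    rw [sub_le_iff_le_add']
    refine ciSup_le fun j => (excessDeviation_update_sub_le h01 (W j) S i z w).trans ?_
    exact add_le_add_left (le_ciSup (hbdd _) j) _
  have htail := measure_exists_mul_sqrt_lt_le (P := P) (ι := Unit)
    (G := fun _ S => F S - ∫ S, F S ∂P) (fun _ => hFm.sub_const _) (L := 0) (σ := 1 / √m)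
    le_rfl (by positivity) (fun t _ => by
      simp only [expSup, iSup_const]
      refine (lintegral_exp_sub_integral_pi_le m hFm hF2 hdiff t).trans_eq ?_
      congr 2
      rw [div_pow, div_pow, Real.sq_sqrt hm'.le]
      field_simp
      ring) hδ hδ1
  refine le_trans (measure_mono ?_) htail
  rintro S ⟨j, hj⟩
  refine ⟨(), ?_⟩
  have := le_ciSup (hbdd S) j
  simp only [zero_add]
  linarith

end Tensor

/-! ### Explicit constants -/

lemma sqrt_add_le_add_sqrt {x y : ℝ} (hx : 0 ≤ x) (hy : 0 ≤ y) : √(x + y) ≤ √x + √y := by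
  refine Real.sqrt_le_iff.2 ⟨by positivity, ?_⟩
  rw [add_sq, Real.sq_sqrt hx, Real.sq_sqrt hy]
  have : 0 ≤ 2 * √x * √y := by positivity
  linarith

lemma sqrt_two_mul_div_sqrt (x : ℝ) {m : ℝ} (hm : 0 < m) :
    √(2 * x) / √m = 2 * √(x / (2 * m)) := by
  rw [← Real.sqrt_div' _ hm.le, show 2 * x / m = 2 ^ 2 * (x / (2 * m)) by field_simp,
    Real.sqrt_mul (by norm_num), Real.sqrt_sq (by norm_num)]

/-- The entropy contribution `σ * √(2 * L)`, for `σ = 16 * a * B₀ / √m` and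
`L = k + 2 * D ^ 2`, against the first term of the risk bound. -/
lemma entropy_term_le {a B₀ B r m k D : ℝ} (ha : 0 ≤ a) (hB : B₀ ≤ B * √r) (hm : 0 < m)
    (hk : 0 ≤ k) (hB0 : 0 ≤ B₀) (hD : 0 ≤ D) :
    16 * a * B₀ / √m * √(2 * (k + 2 * D ^ 2)) ≤
      32 * a * B * √(r / m) * (D + 1 * √(2 * k)) := by
  have h1 : √(2 * (k + 2 * D ^ 2)) ≤ √(2 * k) + 2 * D := by
    rw [show 2 * (k + 2 * D ^ 2) = 2 * k + (2 * D) ^ 2 by ring]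
    refine (sqrt_add_le_add_sqrt (by positivity) (by positivity)).trans_eq ?_
    rw [Real.sqrt_sq (by positivity)]
  have h0 : 0 ≤ √(2 * k) := Real.sqrt_nonneg _
  calc 16 * a * B₀ / √m * √(2 * (k + 2 * D ^ 2))
      ≤ 16 * a * (B * √r) / √m * (2 * (D + 1 * √(2 * k))) := by
        have h2 : 0 ≤ B * √r := hB0.trans hB
        refine mul_le_mul ?_ (by linarith) (by positivity) (by positivity)
        gcongr
    _ = 32 * a * B * √(r / m) * (D + 1 * √(2 * k)) := by
        rw [Real.sqrt_div' _ hm.le]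
        ring

theorem theorem2 :
    ∃ c₁ c₂ C : ℝ, 0 < c₁ ∧ 0 < c₂ ∧ 0 < C ∧
      ∀ (K : ℕ) (_ : 0 < K) (n : Fin K → ℕ) (m : ℕ) (_ : 0 < m)
        (μ : Measure (Tensor n × ℝ)) (_ : IsProbabilityMeasure μ)
        (_ : μ.fst = Tensor.stdGaussian n)
        (Y : Set ℝ) (_ : ∀ᵐ p ∂μ, p.2 ∈ Y)
        (l : ℝ → ℝ → ℝ) (_ : Measurable (Function.uncurry l))
        (Λ : ℝ≥0) (_ : ∀ y ∈ Y, LipschitzWith Λ (fun z => l z y))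
        (_ : ∀ W : Tensor n, Integrable (fun p : Tensor n × ℝ => l (Tensor.dot W p.1) p.2) μ)
        (B₀ B : ℝ) (W₀ : Tensor n)
        (_ : Tensor.IsLatentMinimizer (Tensor.risk l μ) B₀ W₀)
        (_ : Tensor.frobeniusNorm W₀ ≤ B)
        (_ : B₀ ≤ B * √(Tensor.minRank W₀ : ℝ))
        (δ : ℝ) (_ : 0 < δ) (_ : δ < 1),
        -- loss functions with values in `[0, 1]`: all three constants are absolute
        ((∀ z : ℝ, ∀ y ∈ Y, l z y ∈ Set.Icc (0 : ℝ) 1) →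
          Tensor.ExcessRiskLeWithProb l μ m B₀ W₀
            (c₁ * Λ * B * √((Tensor.minRank W₀ : ℝ) / m) *
                (Tensor.dimFactor n + C * √(2 * Real.log K)) +
              c₂ * √(Real.log (2 / δ) / (2 * m))) δ) ∧
        -- arbitrary Lipschitz loss functions: the last constant is scaled by `Λ * B₀`
        Tensor.ExcessRiskLeWithProb l μ m B₀ W₀
          (c₁ * Λ * B * √((Tensor.minRank W₀ : ℝ) / m) *
              (Tensor.dimFactor n + C * √(2 * Real.log K)) +
            (c₂ * (Λ * B₀)) * √(Real.log (2 / δ) / (2 * m))) δ := by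
  refine ⟨32, 32, 1, by norm_num, by norm_num, by norm_num, ?_⟩
  intro K hK n m hm μ hμP hμ Y hY l hl Λ hΛ hi B₀ B W₀ hW₀ _ hB δ hδ hδ1
  obtain ⟨hW₀B, -⟩ := hW₀
  have hm' : (0 : ℝ) < m := by exact_mod_cast hm
  have hB₀ : 0 ≤ B₀ := (Tensor.latentNorm_nonneg _).trans hW₀B
  have hlogK : 0 ≤ Real.log K := Real.log_natCast_nonneg K
  have hlog : 0 ≤ Real.log (1 / δ) := Real.log_nonneg (by rw [le_div_iff₀ hδ]; linarith)
  have hlog2 : Real.log (1 / δ) ≤ Real.log (2 / δ) :=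
    Real.log_le_log (by positivity) (by gcongr; norm_num)
  have hD := Tensor.dimFactor_nonneg n
  -- `Y` need not be measurable, so a measurable set of good sample points replaces it.
  obtain ⟨N, hNY, hN, hNμ⟩ := exists_measurable_superset_of_null (ae_iff.1 hY)
  set Z : Set (Tensor n × ℝ) := Nᶜ with hZdef
  have hZ : MeasurableSet Z := hN.compl
  have hZμ : ∀ᵐ p ∂μ, p ∈ Z := measure_eq_zero_iff_ae_notMem.1 hNμ
  have hZY : ∀ p ∈ Z, p.2 ∈ Y := fun p hp => by
    by_contra h
    exact hp (hNY h)
  have hL : ∀ p ∈ Z, LipschitzWith Λ fun z => l z p.2 := fun p hp => hΛ _ (hZY p hp)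
  have hne : Nonempty {W : Tensor n // Tensor.latentNorm W ≤ B₀} := ⟨⟨W₀, hW₀B⟩⟩
  obtain ⟨W, hW⟩ := TopologicalSpace.exists_dense_seq {W : Tensor n // Tensor.latentNorm W ≤ B₀}
  set σ : ℝ := 16 * Λ * B₀ / √m with hσ
  have hσ0 : 0 ≤ σ := by positivity
  set H : ℝ := Real.log K + 2 * Tensor.dimFactor n ^ 2 with hH
  have hH0 : 0 ≤ H := by positivity
  have hmgf : ∀ t : ℝ, 0 < t →
      ∫⁻ S, expSup (fun j => t * Tensor.excessDeviation l Z μ W₀ (W j) S)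
        ∂(Measure.pi fun _ : Fin m => μ) ≤ ENNReal.ofReal (Real.exp (H + t ^ 2 * σ ^ 2 / 2)) :=
    fun t ht => Tensor.lintegral_expSup_excessDeviation_le hK hm hμ hl hZ hL hi hW₀B
      (fun j => (W j).2) ht
  have hentropy := entropy_term_le Λ.2 hB hm' hlogK hB₀ hD
  have hconf : √(2 * Real.log (1 / δ)) / √m ≤ 2 * √(Real.log (2 / δ) / (2 * m)) := by
    rw [sqrt_two_mul_div_sqrt _ hm']
    gcongr
  have hs := Real.sqrt_nonneg (Real.log (2 / δ) / (2 * m))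
  refine ⟨fun h01 => ?_, ?_⟩
  · refine (Tensor.excessRiskLeWithProb_of_excessDeviation hμ hl hZ hZμ hL hi hW₀B hW hδ.le
      (Tensor.measure_exists_lt_excessDeviation_le hm hl hZ
        (fun p hp z => h01 z _ (hZY p hp)) hH0 hσ0 hmgf hδ hδ1)).mono ?_
    refine add_le_add hentropy ?_
    rw [one_div_mul_eq_div]
    linarith
  · refine (Tensor.excessRiskLeWithProb_of_excessDeviation hμ hl hZ hZμ hL hi hW₀B hW hδ.le
      (measure_exists_mul_sqrt_lt_le (fun j => Tensor.measurable_excessDeviation hl hZ _)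
        hH0 hσ0 hmgf hδ hδ1)).mono ?_
    have hsplit : σ * √(2 * (H + Real.log (1 / δ))) ≤
        σ * √(2 * H) + σ * √(2 * Real.log (1 / δ)) := by
      rw [mul_add 2 H, ← mul_add σ]
      exact mul_le_mul_of_nonneg_left (sqrt_add_le_add_sqrt (mul_nonneg zero_le_two hH0)
        (mul_nonneg zero_le_two hlog)) hσ0
    refine hsplit.trans (add_le_add hentropy ?_)
    calc σ * √(2 * Real.log (1 / δ))
        = 16 * (Λ * B₀) * (√(2 * Real.log (1 / δ)) / √m) := by rw [hσ]; ring
      _ ≤ 16 * (Λ * B₀) * (2 * √(Real.log (2 / δ) / (2 * m))) := by gcongr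
      _ = 32 * (Λ * B₀) * √(Real.log (2 / δ) / (2 * m)) := by ring
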